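/- Write $\ell^\infty(\mathbb N_0)$ for the bounded complex sequences indexed by $\mathbb N_0$. For $x,c\in\mathbb C$ with $|x|\le 1$ let $v(x\,;c)\in\ell^\infty(\mathbb N_0)$ be the sequence with $(v(x\,;c))_0=c$ and $(v(x\,;c))_n=-\frac{(-x)^n}{n}$ for $n\ge 1$, and let $V\subset\ell^\infty(\mathbb N_0)$ be the algebraic $\mathbb C$-linear span of all these sequences. For a real $2\times2$ matrix put $$F\begin{pmatrix}p&q\\ r&s\end{pmatrix}=\frac12\begin{pmatrix}p-q-r+s&p+q-r-s\\ p-q+r-s&p+q+r+s\end{pmatrix},$$ and for a matrix $M=\begin{pmatrix}\alpha&\beta\\ \gamma&\delta\end{pmatrix}$ let $[M](x)=\frac{\alpha x+\beta}{\gamma x+\delta}$. **Theorem.** Let $(A_i)_{i\in I}$ be a finite family of invertible real $2\times2$ matrices with all entries positive, let $(w_i)_{i\in I}$ satisfy $w_i>0$ and $\sum_i w_i=1$, and let $\mu$ be the Bernoulli (infinite product) measure on $I^{\mathbb N}$ with weights $(w_i)$. Let $f_i=[F(A_i)]$ and $f_i^{\top}=[F(A_i)^{\top}]$. Then $\det F(A_i)/f_i'(0)>0$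 for every $i$. Define $b_{k,0}=0$ for $k\ge0$, $b_{0,n}=\sum_{i} w_i\,(f_i^{\top}(0))^n$ for $n\ge1$, and $$b_{k,n}=\sum_{i\in I} w_i\sum_{\ell=1}^{\min\{k,n\}}\binom{n}{\ell}\binom{k-1}{\ell-1}(f_i^{\top}(0))^{n-\ell}(-f_i(0))^{k-\ell}(f_i'(0))^{\ell}\qquad(k,n\ge1).$$ For every $u\in V$ and $k\ge 0$ the series $(Tu)_k=\sum_{n=0}^\infty b_{k,n}u_n$ converges absolutely, and $Tu\in V$; so $T$ is a linear operator $V\to V$. The vector $$\boldsymbol v=\sum_{i\in I} w_i\, v\!\left(f_i(0)\,;\ \tfrac12\log\frac{\det F(A_i)}{f_i'(0)}\right)$$ lies in $V$. The top Lyapunov exponent $\lambda\in\mathbb R$, that is, the limit $\lambda=\lim_{n\to\infty}\frac1n\log\|A_{i_n}\cdots A_{i_1}\|$ for $\mu$-almost every $(i_n)_{n\ge 1}$ (the same for every norm on the $2\times 2$ matrices), exists, and $$\lambda=\sum_{n=0}^\infty (T^n\boldsymbol v)_0,$$ where the series converges absolutely. -/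

import Mathlib

open MeasureTheory Filter Topology

noncomputable section

namespace KernelExpansion

/-- The matrix `F(A)`: the action of `A` on the simplex `{v ≥ 0, v₁ + v₂ = 1}`, written in the
coordinate `x ∈ [-1, 1]` with `v = (1 + x, 1 - x) / 2`, is the Möbius map with matrix `F(A)`. -/
def projMatrix (A : Matrix (Fin 2) (Fin 2) ℝ) : Matrix (Fin 2) (Fin 2) ℝ :=
  (1 / 2 : ℝ) •
    !![A 0 0 - A 0 1 - A 1 0 + A 1 1, A 0 0 + A 0 1 - A 1 0 - A 1 1;
       A 0 0 - A 0 1 + A 1 0 - A 1 1, A 0 0 + A 0 1 + A 1 0 + A 1 1]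

/-- The Möbius map `x ↦ (α x + β) / (γ x + δ)` of a real matrix, on the real points that are not
poles. -/
def mobius (M : Matrix (Fin 2) (Fin 2) ℝ) (x : ℝ) : ℝ :=
  (M 0 0 * x + M 0 1) / (M 1 0 * x + M 1 1)

/-- The projective map `f_A = [F(A)]`. -/
def projMap (A : Matrix (Fin 2) (Fin 2) ℝ) : ℝ → ℝ :=
  mobius (projMatrix A)

/-- The transposed projective map `f_Aᵀ = [F(A)ᵀ]`. -/
def projMapT (A : Matrix (Fin 2) (Fin 2) ℝ) : ℝ → ℝ :=
  mobius (projMatrix A).transpose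

/-- The sequence `v(x ; c)`: its entry of index `0` is `c`, and its entry of index `n ≥ 1` is
`-(-x)ⁿ / n`. -/
def kernelVec (x c : ℂ) (n : ℕ) : ℂ :=
  if n = 0 then c else -((-x) ^ n / (n : ℂ))

/-- The space `V`: the algebraic complex linear span of the sequences `v(x ; c)`, `|x| ≤ 1`. -/
def kernelSpan : Submodule ℂ (ℕ → ℂ) :=
  Submodule.span ℂ {u | ∃ x c : ℂ, ‖x‖ ≤ 1 ∧ u = kernelVec x c}

/-- `V` consists of bounded sequences. -/
theorem exists_norm_le_of_mem_kernelSpan {u : ℕ → ℂ} (hu : u ∈ kernelSpan) :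
    ∃ C : ℝ, ∀ n, ‖u n‖ ≤ C := by
  induction hu using Submodule.span_induction with
  | mem u hu =>
    obtain ⟨x, c, hx, rfl⟩ := hu
    refine ⟨max ‖c‖ 1, fun n => ?_⟩
    unfold kernelVec
    split_ifs with hn
    · exact le_max_left _ _
    · refine le_trans ?_ (le_max_right _ _)
      have h1 : (1 : ℝ) ≤ n := by exact_mod_cast Nat.one_le_iff_ne_zero.mpr hn
      rw [norm_neg, norm_div, norm_pow, norm_neg, Complex.norm_natCast]
      exact div_le_one_of_le₀ ((pow_le_one₀ (norm_nonneg _) hx).trans h1) (by positivity)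
  | zero => exact ⟨0, fun n => by simp⟩
  | add u v _ _ hu hv =>
    obtain ⟨C, hC⟩ := hu
    obtain ⟨D, hD⟩ := hv
    exact ⟨C + D, fun n => (norm_add_le _ _).trans (add_le_add (hC n) (hD n))⟩
  | smul a u _ hu =>
    obtain ⟨C, hC⟩ := hu
    refine ⟨‖a‖ * C, fun n => ?_⟩
    rw [Pi.smul_apply, norm_smul]
    exact mul_le_mul_of_nonneg_left (hC n) (norm_nonneg _)

variable {I : Type*} [Fintype I]

/-- The vector `∑ i, w_i • v(f_i(0) ; (1/2) log (det F(A_i) / f_i'(0)))`. -/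
def initVec (A : I → Matrix (Fin 2) (Fin 2) ℝ) (w : I → ℝ) : ℕ → ℂ :=
  ∑ i, (w i : ℂ) • kernelVec (projMap (A i) 0 : ℂ)
    ((1 / 2 * Real.log ((projMatrix (A i)).det / deriv (projMap (A i)) 0) : ℝ) : ℂ)

/-- The entries `b_{k,n}` of the infinite matrix `T`. -/
def kernelCoeff (A : I → Matrix (Fin 2) (Fin 2) ℝ) (w : I → ℝ) (k n : ℕ) : ℝ :=
  if n = 0 then 0
  else if k = 0 then ∑ i, w i * projMapT (A i) 0 ^ n
  else ∑ i, w i * ∑ l ∈ Finset.Icc 1 (min k n),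
    (n.choose l : ℝ) * ((k - 1).choose (l - 1) : ℝ) * projMapT (A i) 0 ^ (n - l)
      * (-projMap (A i) 0) ^ (k - l) * deriv (projMap (A i)) 0 ^ l

/-- The Bernoulli measure on `I^ℕ` with weights `w`: the infinite product of the measure on `I`
that gives each `i` the mass `w i`. -/
def bernoulliMeasure [MeasurableSpace I] (w : I → ℝ) : Measure (ℕ → I) :=
  Measure.infinitePi fun _ : ℕ => ∑ i, ENNReal.ofReal (w i) • Measure.dirac i

/-- The product `A_{ω (n-1)} ⋯ A_{ω 1} A_{ω 0}` of the first `n` matrices along `ω`, the latest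
one on the left. -/
def matProd {J : Type*} (A : J → Matrix (Fin 2) (Fin 2) ℝ) (ω : ℕ → J) :
    ℕ → Matrix (Fin 2) (Fin 2) ℝ
  | 0 => 1
  | n + 1 => A (ω n) * matProd A ω n

/-- `L` is the top Lyapunov exponent: for every norm `N` on the `2 × 2` matrices (a seminorm that
vanishes only at `0`), `(1/n) log N(A_{i_n} ⋯ A_{i_1})` tends to `L` for almost every sequence. -/
def IsTopLyapunovExponent [MeasurableSpace I] (A : I → Matrix (Fin 2) (Fin 2) ℝ) (w : I → ℝ)
    (L : ℝ) : Prop :=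
  ∀ N : Seminorm ℝ (Matrix (Fin 2) (Fin 2) ℝ), (∀ M, N M = 0 → M = 0) →
    ∀ᵐ ω ∂(bernoulliMeasure w),
      Tendsto (fun n : ℕ => 1 / (n : ℝ) * Real.log (N (matProd A ω n))) atTop (𝓝 L)

end KernelExpansion

end

namespace KernelExpansion

/-! In the simplex coordinate `x`, a positive matrix acts on directions by the Möbius map `f_i =
[F(A_i)]` and multiplies the coordinate sum by `growth (A i) x`, the denominator of `f_i`. Let `P g
= ∑ i, w_i • g ∘ f_i` (`transfer`), let `φ` be the mean of the logarithmic growth (`meanLogGrowth`),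
and let `κ x = v(x ; 0)` (`kernelPoint`) and `e₀ = (1, 0, 0, …)` (`kernelUnit`). The proof computes
`T ^ n` on the initial vector and identifies the sum of the zeroth entries with `λ`.

The coefficients of `T` encode composition of power series. Row `0` sums to `log (1 + f_iᵀ(0) x)`,
which is the log growth at `x` minus that at `0`; the other rows turn `v(x ; ·)` into `v(f_i x ; ·)
- v(f_i 0 ; 0)`. Hence `T κ(x) = (Pκ)(x) - (Pκ)(0) + (φ(x) - φ(0)) e₀` (`kernelOp_kernelPoint`),
while `T e₀ = 0`. The initial vector is `(Pκ)(0) + φ(0) e₀` (`initVec_eq`), so by induction `T ^ n`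
sends it to `(P^{n+1}κ)(0) - (P^n κ)(0)` plus `e₀` times the `n`th increment of `n ↦ (P^n φ)(0)`,
the zeroth increment being `φ(0)` (`kernelOp_pow_apply`). All `κ(x)` have zeroth entry `0`, so the
series telescopes to `lim (P^n φ)(0)`. Positivity makes the `f_i` uniform contractions of the
Hilbert metric, so the increments decay geometrically (`exists_geometric_bound`).

The same limit is the Lyapunov exponent. The logarithm of the entry sum of a product is `log 2` plus
the log growths along the orbit of `0`, with mean `log 2 + ∑_{k<n} (P^k φ)(0)`
(`integral_log_entrySum`). It is additive over consecutive blocks up to a bounded error, so the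
strong law for independent blocks of length `m`, followed by `m → ∞`, gives almost sure convergence
(`isTopLyapunovExponent_of_tendsto`). -/

/-! ### Power series identities -/

/-- Since `C(n, j+1) / n = C(n-1, j) / (j+1)`, this is the negative binomial series in `-g x`,
shifted by `j + 1`. -/
theorem hasSum_choose_mul_geometric_div {g x : ℂ} (h : ‖g * x‖ < 1) (j : ℕ) :
    HasSum (fun n : ℕ => (n.choose (j + 1) : ℂ) * g ^ (n - (j + 1)) * (-((-x) ^ n / (n : ℂ))))
      (-((-x / (1 + g * x)) ^ (j + 1) / ((j : ℂ) + 1))) := by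
  have hr : ‖-(g * x)‖ < 1 := by rwa [norm_neg]
  have h1 := (hasSum_choose_mul_geometric_of_norm_lt_one j hr).mul_left
    (-((-x) ^ (j + 1) / ((j : ℂ) + 1)))
  rw [sub_neg_eq_add] at h1
  -- The terms with `n ≤ j` vanish with their binomial coefficients; this includes `n = 0`, where
  -- the division is by zero.
  rw [← hasSum_nat_add_iff' (j + 1), Finset.sum_eq_zero, sub_zero]
  · convert! h1 using 1
    · funext m
      have h2 : ((m + j : ℕ) + 1 : ℂ) * ((m + j).choose j : ℂ)
          = ((m + (j + 1)).choose (j + 1) : ℂ) * ((j : ℂ) + 1) := by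
        exact_mod_cast Nat.add_one_mul_choose_eq (m + j) j
      have h3 : ((m : ℂ) + ((j : ℂ) + 1)) ≠ 0 := by exact_mod_cast Nat.succ_ne_zero (m + j)
      have h4 : ((j : ℂ) + 1) ≠ 0 := by exact_mod_cast Nat.succ_ne_zero j
      have h5 : ((m + (j + 1)).choose (j + 1) : ℂ)
          = ((m : ℂ) + ((j : ℂ) + 1)) * ((m + j).choose j : ℂ) / ((j : ℂ) + 1) := by
        rw [eq_div_iff h4, ← h2]; push_cast; ring
      rw [h5, Nat.add_sub_cancel]
      push_cast
      rw [show (-(g * x)) ^ m = g ^ m * (-x) ^ m by rw [← mul_pow]; ring]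
      field_simp
      ring
    · rw [div_pow]; ring
  · intro n hn
    rw [Nat.choose_eq_zero_of_lt (Finset.mem_range.mp hn)]
    simp

/-- Since `C(k, j) / (j+1) = C(k+1, j+1) / (k+1)`, this is the binomial theorem for `(y - b)^(k+1)`
without its term of degree `0` in `y`. -/
theorem sum_choose_mul_div_eq (k : ℕ) (b y : ℂ) :
    ∑ j ∈ Finset.range (k + 1), (k.choose j : ℂ) * (-b) ^ (k - j) * (y ^ (j + 1) / ((j : ℂ) + 1))
      = ((y - b) ^ (k + 1) - (-b) ^ (k + 1)) / ((k : ℂ) + 1) := by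
  have hk : ((k : ℂ) + 1) ≠ 0 := by exact_mod_cast Nat.succ_ne_zero k
  rw [eq_div_iff hk, sub_eq_add_neg y b, add_pow, Finset.sum_range_succ' _ (k + 1), Finset.sum_mul]
  simp only [pow_zero, one_mul, Nat.sub_zero, Nat.choose_zero_right, Nat.cast_one, mul_one,
    add_sub_cancel_right]
  refine Finset.sum_congr rfl fun j _ => ?_
  have hj : ((j : ℂ) + 1) ≠ 0 := by exact_mod_cast Nat.succ_ne_zero j
  have h2 : ((k : ℂ) + 1) * (k.choose j : ℂ) = ((k + 1).choose (j + 1) : ℂ) * ((j : ℂ) + 1) := by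
    exact_mod_cast Nat.add_one_mul_choose_eq k j
  have h5 : ((k + 1).choose (j + 1) : ℂ) = ((k : ℂ) + 1) * (k.choose j : ℂ) / ((j : ℂ) + 1) := by
    rw [eq_div_iff hj, ← h2]
  rw [h5, Nat.add_sub_add_right]
  ring

/-- With `b = f(0)`, `D = f'(0)` and `g = fᵀ(0)`, the point `b + D x / (1 + g x)` is `f(x)`. The
preceding lemma is applied with `y = -D x / (1 + g x)`; its missing binomial term is the source of
the correction `-v(f(0) ; 0)`. -/
theorem hasSum_compose_mobius {g x : ℂ} (h : ‖g * x‖ < 1) (b D : ℂ) (k : ℕ) :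
    HasSum (fun n : ℕ => (∑ l ∈ Finset.Icc 1 (min (k + 1) n),
        (n.choose l : ℂ) * (k.choose (l - 1) : ℂ) * g ^ (n - l) * (-b) ^ (k + 1 - l) * D ^ l)
          * (-((-x) ^ n / (n : ℂ))))
      (-((-(b + D * x / (1 + g * x))) ^ (k + 1) / ((k : ℂ) + 1))
        + (-b) ^ (k + 1) / ((k : ℂ) + 1)) := by
  have h1 := hasSum_sum (s := Finset.range (k + 1)) fun j _ =>
    (hasSum_choose_mul_geometric_div h j).mul_left
      ((k.choose j : ℂ) * (-b) ^ (k - j) * D ^ (j + 1))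
  convert! h1 using 1
  · funext n
    have h2 : ∑ l ∈ Finset.Icc 1 (min (k + 1) n),
        (n.choose l : ℂ) * (k.choose (l - 1) : ℂ) * g ^ (n - l) * (-b) ^ (k + 1 - l) * D ^ l
        = ∑ l ∈ Finset.Icc 1 (k + 1),
        (n.choose l : ℂ) * (k.choose (l - 1) : ℂ) * g ^ (n - l) * (-b) ^ (k + 1 - l) * D ^ l := by
      refine Finset.sum_subset (Finset.Icc_subset_Icc_right (min_le_left _ _)) fun l hl hl' => ?_
      rw [Finset.mem_Icc] at hl hl'
      rw [Nat.choose_eq_zero_of_lt (by omega)]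
      simp
    rw [h2, Finset.sum_mul, ← Finset.Ico_add_one_right_eq_Icc, Finset.sum_Ico_eq_sum_range]
    refine Finset.sum_congr (by simp) fun j _ => ?_
    rw [add_comm 1 j, Nat.add_sub_cancel, Nat.add_sub_add_right]
    ring
  · have h2 := sum_choose_mul_div_eq k b (D * (-x / (1 + g * x)))
    have h3 : D * (-x / (1 + g * x)) - b = -(b + D * x / (1 + g * x)) := by ring
    rw [h3] at h2
    rw [← neg_inj, ← Finset.sum_neg_distrib]
    trans ((-(b + D * x / (1 + g * x))) ^ (k + 1) - (-b) ^ (k + 1)) / ((k : ℂ) + 1)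
    · ring
    · rw [← h2]
      refine Finset.sum_congr rfl fun j _ => ?_
      rw [mul_pow]; ring

/-! ### The matrices `F(A)` -/

section Matrix

variable {A : Matrix (Fin 2) (Fin 2) ℝ}

theorem projMatrix_bottom_pos (hA : ∀ a b, 0 < A a b) : 0 < projMatrix A 1 1 := by
  have := hA 0 0; have := hA 0 1; have := hA 1 0; have := hA 1 1
  simp [projMatrix]; linarith

theorem abs_projMatrix_bottom_lt (hA : ∀ a b, 0 < A a b) :
    |projMatrix A 1 0| < projMatrix A 1 1 := by
  have := hA 0 0; have := hA 0 1; have := hA 1 0; have := hA 1 1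
  rw [abs_lt]
  constructor <;> simp [projMatrix] <;> linarith

theorem det_projMatrix (A : Matrix (Fin 2) (Fin 2) ℝ) : (projMatrix A).det = A.det := by
  simp [Matrix.det_fin_two, projMatrix]; ring

theorem projMap_zero (A : Matrix (Fin 2) (Fin 2) ℝ) :
    projMap A 0 = projMatrix A 0 1 / projMatrix A 1 1 := by
  simp [projMap, mobius]

theorem projMapT_zero (A : Matrix (Fin 2) (Fin 2) ℝ) :
    projMapT A 0 = projMatrix A 1 0 / projMatrix A 1 1 := by
  simp [projMapT, mobius]

theorem deriv_projMap_zero (hA : ∀ a b, 0 < A a b) :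
    deriv (projMap A) 0 = (projMatrix A).det / projMatrix A 1 1 ^ 2 := by
  have hd := projMatrix_bottom_pos hA
  have h1 : HasDerivAt (fun x : ℝ => projMatrix A 0 0 * x + projMatrix A 0 1)
      (projMatrix A 0 0) 0 := by
    simpa using ((hasDerivAt_id (0 : ℝ)).const_mul (projMatrix A 0 0)).add_const (projMatrix A 0 1)
  have h2 : HasDerivAt (fun x : ℝ => projMatrix A 1 0 * x + projMatrix A 1 1)
      (projMatrix A 1 0) 0 := by
    simpa using ((hasDerivAt_id (0 : ℝ)).const_mul (projMatrix A 1 0)).add_const (projMatrix A 1 1)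
  have h3 := (h1.fun_div h2 (by simpa using hd.ne')).deriv
  rw [show projMap A = fun x : ℝ => (projMatrix A 0 0 * x + projMatrix A 0 1) /
    (projMatrix A 1 0 * x + projMatrix A 1 1) from rfl, h3, Matrix.det_fin_two]
  simp

/-- Invertibility keeps `f'(0)` nonzero. Half the logarithm of the quotient is then the log growth
at the origin. -/
theorem det_div_deriv_projMap (hA : ∀ a b, 0 < A a b) (hA' : IsUnit A) :
    (projMatrix A).det / deriv (projMap A) 0 = projMatrix A 1 1 ^ 2 := by
  have hd := projMatrix_bottom_pos hA
  have hdet : (projMatrix A).det ≠ 0 := by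
    rw [det_projMatrix]
    exact ((Matrix.isUnit_iff_isUnit_det A).mp hA').ne_zero
  rw [deriv_projMap_zero hA]
  field_simp

/-- The complex extension of `projMap`. -/
noncomputable def projMapC (A : Matrix (Fin 2) (Fin 2) ℝ) (x : ℂ) : ℂ :=
  ((projMatrix A 0 0 : ℂ) * x + projMatrix A 0 1) / ((projMatrix A 1 0 : ℂ) * x + projMatrix A 1 1)

theorem ofReal_projMap (A : Matrix (Fin 2) (Fin 2) ℝ) (x : ℝ) :
    (projMap A x : ℂ) = projMapC A x := by
  simp [projMap, mobius, projMapC]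

/-- For `A` with rows `(p, q)`, `(r, s)`, the squared modulus of the denominator minus that of the
numerator is `p r |1+x|² + q s |1-x|² + (p s + q r)(1 - |x|²)`, which is nonnegative on the disc. -/
theorem norm_projMapC_le (hA : ∀ a b, 0 < A a b) {x : ℂ} (hx : ‖x‖ ≤ 1) : ‖projMapC A x‖ ≤ 1 := by
  rw [projMapC, norm_div]
  refine div_le_one_of_le₀ ?_ (norm_nonneg _)
  rw [← sq_le_sq₀ (norm_nonneg _) (norm_nonneg _), Complex.sq_norm, Complex.sq_norm,
    Complex.normSq_apply, Complex.normSq_apply]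
  have h := sq_le_one_iff₀ (norm_nonneg x) |>.mpr hx
  rw [Complex.sq_norm, Complex.normSq_apply] at h
  simp only [Complex.add_re, Complex.add_im, Complex.re_ofReal_mul, Complex.im_ofReal_mul,
    Complex.ofReal_re, Complex.ofReal_im]
  generalize x.re = u at *
  generalize x.im = v at *
  have h00 := hA 0 0; have h01 := hA 0 1; have h10 := hA 1 0; have h11 := hA 1 1
  simp [projMatrix]
  generalize A 0 0 = p at *
  generalize A 0 1 = q at *
  generalize A 1 0 = r at *
  generalize A 1 1 = s at *
  have e1 : 0 ≤ p * r * ((1 + u) ^ 2 + v ^ 2) := by positivity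
  have e2 : 0 ≤ q * s * ((1 - u) ^ 2 + v ^ 2) := by positivity
  have e3 : 0 ≤ (p * s + q * r) * (1 - (u * u + v * v)) :=
    mul_nonneg (by positivity) (by linarith)
  nlinarith

theorem norm_mul_lt_one (hA : ∀ a b, 0 < A a b) {x : ℂ} (hx : ‖x‖ ≤ 1) :
    ‖(projMapT A 0 : ℂ) * x‖ < 1 := by
  have hd := projMatrix_bottom_pos hA
  rw [norm_mul, projMapT_zero, Complex.norm_real, Real.norm_eq_abs, abs_div, abs_of_pos hd]
  have h1 : |projMatrix A 1 0| / projMatrix A 1 1 < 1 :=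
    (div_lt_one hd).mpr (abs_projMatrix_bottom_lt hA)
  calc _ ≤ |projMatrix A 1 0| / projMatrix A 1 1 * 1 := by gcongr
    _ < 1 := by simpa using h1

theorem projMapC_eq (hA : ∀ a b, 0 < A a b) {x : ℂ} (hx : ‖x‖ ≤ 1) :
    (projMap A 0 : ℂ) + ((deriv (projMap A) 0 : ℝ) : ℂ) * x / (1 + (projMapT A 0 : ℂ) * x)
      = projMapC A x := by
  have hd : (projMatrix A 1 1 : ℂ) ≠ 0 := by exact_mod_cast (projMatrix_bottom_pos hA).ne'
  have h1 : (1 + (projMapT A 0 : ℂ) * x) ≠ 0 := by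
    intro h0
    have := norm_mul_lt_one hA hx
    rw [eq_neg_of_add_eq_zero_right h0] at this
    simp at this
  rw [deriv_projMap_zero hA, projMap_zero, Matrix.det_fin_two, projMapC]
  rw [projMapT_zero] at h1 ⊢
  push_cast at h1 ⊢
  have h2 : (projMatrix A 1 0 : ℂ) * x + projMatrix A 1 1 ≠ 0 := by
    intro h0
    apply h1
    field_simp
    linear_combination h0
  have h3 : (1 + (projMatrix A 1 0 : ℂ) / projMatrix A 1 1 * x)
    = (projMatrix A 1 0 * x + projMatrix A 1 1) / projMatrix A 1 1 := by field_simp; ring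
  rw [h3]
  field_simp
  ring

end Matrix

/-! ### The operator on kernel vectors -/

section Operator

variable {I : Type*} [Fintype I] {A : I → Matrix (Fin 2) (Fin 2) ℝ}

theorem kernelVec_mem {x : ℂ} (hx : ‖x‖ ≤ 1) (c : ℂ) : kernelVec x c ∈ kernelSpan :=
  Submodule.subset_span ⟨x, c, hx, rfl⟩

theorem hasSum_kernelCoeff_kernelVec (hA : ∀ i a b, 0 < A i a b) (w : I → ℝ) {x : ℂ}
    (hx : ‖x‖ ≤ 1) (c : ℂ) (k : ℕ) :
    HasSum (fun n => (kernelCoeff A w k n : ℂ) * kernelVec x c n)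
      ((∑ i, (w i : ℂ) • (kernelVec (projMapC (A i) x) (Complex.log (1 + projMapT (A i) 0 * x))
        - kernelVec (projMap (A i) 0 : ℂ) 0)) k) := by
  rw [Finset.sum_apply]
  simp only [Pi.smul_apply, Pi.sub_apply, smul_eq_mul]
  rcases k with _ | k
  -- Row `0` is the Taylor series of `log (1 + z)` at `z = f_iᵀ(0) x`.
  · have h1 := hasSum_sum (s := Finset.univ) fun (i : I) _ =>
      (Complex.hasSum_taylorSeries_log (norm_mul_lt_one (hA i) hx)).mul_left (w i : ℂ)
    convert! h1 using 1
    · funext n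
      by_cases hn : n = 0
      · subst hn; simp [kernelCoeff]
      · simp only [kernelCoeff, hn, if_false, if_true, kernelVec]
        push_cast
        rw [Finset.sum_mul]
        refine Finset.sum_congr rfl fun i _ => ?_
        rw [mul_pow, neg_pow x]; ring
    · simp [kernelVec]
  · have h1 := hasSum_sum (s := Finset.univ) fun (i : I) _ =>
      (hasSum_compose_mobius (norm_mul_lt_one (hA i) hx) (projMap (A i) 0 : ℝ)
        (deriv (projMap (A i)) 0 : ℝ) k).mul_left (w i : ℂ)
    convert! h1 using 1
    · funext n
      by_cases hn : n = 0
      · subst hn; simp [kernelCoeff]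
      · simp only [kernelCoeff, hn, if_false, kernelVec, Nat.succ_ne_zero, Nat.add_sub_cancel]
        push_cast
        rw [Finset.sum_mul]
        refine Finset.sum_congr rfl fun i _ => ?_
        ring
    · refine Finset.sum_congr rfl fun i _ => ?_
      rw [projMapC_eq (hA i) hx]
      simp [kernelVec]

theorem exists_hasSum_kernelCoeff (hA : ∀ i a b, 0 < A i a b) (w : I → ℝ) {u : ℕ → ℂ}
    (hu : u ∈ kernelSpan) :
    ∃ u' ∈ kernelSpan, ∀ k, HasSum (fun n => (kernelCoeff A w k n : ℂ) * u n) (u' k) := by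
  induction hu using Submodule.span_induction with
  | mem u hu =>
    obtain ⟨x, c, hx, rfl⟩ := hu
    refine ⟨_, ?_, hasSum_kernelCoeff_kernelVec hA w hx c⟩
    refine Submodule.sum_mem _ fun i _ => Submodule.smul_mem _ _ (Submodule.sub_mem _ ?_ ?_)
    · exact kernelVec_mem (norm_projMapC_le (hA i) hx) _
    · have := norm_projMapC_le (hA i) (x := ((0 : ℝ) : ℂ)) (by simp)
      rw [← ofReal_projMap] at this
      exact kernelVec_mem this _
  | zero => exact ⟨0, Submodule.zero_mem _, fun k => by simp⟩
  | add u v _ _ hu hv =>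
    obtain ⟨u', hu', hu⟩ := hu
    obtain ⟨v', hv', hv⟩ := hv
    refine ⟨u' + v', Submodule.add_mem _ hu' hv', fun k => ?_⟩
    simpa [mul_add] using (hu k).add (hv k)
  | smul a u _ hu =>
    obtain ⟨u', hu', hu⟩ := hu
    refine ⟨a • u', Submodule.smul_mem _ _ hu', fun k => ?_⟩
    simpa [mul_left_comm] using (hu k).mul_left a

/-- The operator `T` on `V`. -/
noncomputable def kernelOp (hA : ∀ i a b, 0 < A i a b) (w : I → ℝ) :
    kernelSpan →ₗ[ℂ] kernelSpan where
  toFun u := ⟨_, (exists_hasSum_kernelCoeff hA w u.2).choose_spec.1⟩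
  map_add' u v := by
    ext k
    have h := fun u : kernelSpan => (exists_hasSum_kernelCoeff hA w u.2).choose_spec.2 k
    refine (h (u + v)).unique ?_
    simpa [mul_add] using (h u).add (h v)
  map_smul' a u := by
    ext k
    have h := fun u : kernelSpan => (exists_hasSum_kernelCoeff hA w u.2).choose_spec.2 k
    refine (h (a • u)).unique ?_
    simpa [mul_left_comm] using (h u).mul_left a

theorem hasSum_kernelOp (hA : ∀ i a b, 0 < A i a b) (w : I → ℝ) (u : kernelSpan) (k : ℕ) :
    HasSum (fun n : ℕ => (kernelCoeff A w k n : ℂ) * (u : ℕ → ℂ) n)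
      ((kernelOp hA w u : ℕ → ℂ) k) :=
  (exists_hasSum_kernelCoeff hA w u.2).choose_spec.2 k

theorem kernelOp_eq_of_kernelVec (hA : ∀ i a b, 0 < A i a b) (w : I → ℝ) {u : kernelSpan} {x c : ℂ}
    (hx : ‖x‖ ≤ 1) (hu : (u : ℕ → ℂ) = kernelVec x c) :
    (kernelOp hA w u : ℕ → ℂ) = ∑ i, (w i : ℂ) •
      (kernelVec (projMapC (A i) x) (Complex.log (1 + projMapT (A i) 0 * x))
        - kernelVec (projMap (A i) 0 : ℂ) 0) := by
  funext k
  refine (hasSum_kernelOp hA w u k).unique ?_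
  rw [hu]
  exact hasSum_kernelCoeff_kernelVec hA w hx c k

end Operator

/-! ### The transfer operator -/

section Transfer

variable {R I X E E' : Type*} [Fintype I]

section Semiring

variable [CommSemiring R] [AddCommMonoid E] [Module R E] [AddCommMonoid E'] [Module R E']

/-- The averaging operator `g ↦ ∑ i, w i • g ∘ f i`. -/
def transfer (w : I → R) (f : I → X → X) : (X → E) →ₗ[R] (X → E) where
  toFun g x := ∑ i, w i • g (f i x)
  map_add' g g' := by
    funext x
    simp [smul_add, Finset.sum_add_distrib]
  map_smul' c g := by
    funext x
    simp only [Pi.smul_apply, RingHom.id_apply, Finset.smul_sum]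
    exact Finset.sum_congr rfl fun i _ => smul_comm _ _ _

theorem transfer_apply (w : I → R) (f : I → X → X) (g : X → E) (x : X) :
    transfer w f g x = ∑ i, w i • g (f i x) := rfl

theorem transfer_pow_const {w : I → R} (hw : ∑ i, w i = 1) (f : I → X → X) (e : E) (n : ℕ) :
    (transfer w f ^ n) (fun _ => e) = fun _ => e := by
  induction n with
  | zero => rfl
  | succ n ih =>
    rw [pow_succ', Module.End.mul_apply, ih]
    funext x
    rw [transfer_apply, ← Finset.sum_smul, hw, one_smul]

/-- Averaging commutes with linear maps of the values; this moves `T` and `headEntry` inside the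
averages of `kernelPoint`. -/
theorem transfer_pow_comp (w : I → R) (f : I → X → X) (L : E →ₗ[R] E') (g : X → E) (n : ℕ) (x : X) :
    L ((transfer w f ^ n) g x) = (transfer w f ^ n) (fun y => L (g y)) x := by
  induction n generalizing x with
  | zero => rfl
  | succ n ih =>
    simp only [pow_succ', Module.End.mul_apply, transfer_apply, map_sum, map_smul, ih]

end Semiring

theorem ofReal_transfer_pow (w : I → ℝ) (f : I → X → X) (g : X → ℝ) (n : ℕ) (x : X) :
    (((transfer w f ^ n) g x : ℝ) : ℂ)
      = (transfer (fun i => (w i : ℂ)) f ^ n) (fun y => (g y : ℂ)) x := by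
  induction n generalizing x with
  | zero => rfl
  | succ n ih =>
    simp only [pow_succ', Module.End.mul_apply, transfer_apply, smul_eq_mul, Complex.ofReal_sum,
      Complex.ofReal_mul, ih]

end Transfer

/-! ### The projective action on `[-1, 1]` -/

/-- The projective state space. -/
abbrev State : Type := Set.Icc (-1 : ℝ) 1

/-- The state of the vector `(1/2, 1/2)`. -/
def origin : State := ⟨0, by norm_num⟩

/-- The factor by which `A` multiplies the sum of the coordinates of the vector of state `x`. -/
noncomputable def growth (A : Matrix (Fin 2) (Fin 2) ℝ) (x : ℝ) : ℝ :=
  projMatrix A 1 0 * x + projMatrix A 1 1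

section Matrix

variable {A : Matrix (Fin 2) (Fin 2) ℝ}

theorem growth_lower (A : Matrix (Fin 2) (Fin 2) ℝ) (x : State) :
    projMatrix A 1 1 - |projMatrix A 1 0| ≤ growth A x := by
  have h1 : |projMatrix A 1 0 * x| ≤ |projMatrix A 1 0| := by
    rw [abs_mul]
    exact mul_le_of_le_one_right (abs_nonneg _) (abs_le.mpr x.2)
  rw [growth]
  linarith [neg_abs_le (projMatrix A 1 0 * x)]

theorem growth_pos (hA : ∀ a b, 0 < A a b) (x : State) : 0 < growth A x :=
  (sub_pos.mpr (abs_projMatrix_bottom_lt hA)).trans_le (growth_lower A x)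

theorem abs_projMap_lt_one (hA : ∀ a b, 0 < A a b) (x : State) : |projMap A x| < 1 := by
  obtain ⟨x, hx1, hx2⟩ := x
  have hg := growth_pos hA ⟨x, hx1, hx2⟩
  change 0 < growth A x at hg
  change |(projMatrix A 0 0 * x + projMatrix A 0 1) / growth A x| < 1
  have h00 := hA 0 0; have h01 := hA 0 1; have h10 := hA 1 0; have h11 := hA 1 1
  rw [abs_div, abs_of_pos hg, div_lt_one hg, abs_lt]
  have e (a b : ℝ) (ha : 0 < a) (hb : 0 < b) : 0 < a * (1 + x) + b * (1 - x) := by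
    rcases hx1.lt_or_eq with h | h
    · exact add_pos_of_pos_of_nonneg (mul_pos ha (by linarith)) (mul_nonneg hb.le (by linarith))
    · rw [← h]; linarith
  have e1 := e _ _ h00 h01
  have e2 := e _ _ h10 h11
  constructor <;> simp [projMatrix, growth] <;> linarith

/-- The projective map as a self-map of the state space. -/
noncomputable def stateMap (hA : ∀ a b, 0 < A a b) (x : State) : State :=
  ⟨projMap A x, abs_le.mp (abs_projMap_lt_one hA x).le⟩

/-- Birkhoff contraction: `|x - y| / (1 - x y)` is `tanh` of half the Hilbert distance. Multiplying
out the denominators also admits the endpoints. -/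
theorem stateMap_contract (hA : ∀ a b, 0 < A a b) (x y : State) :
    |projMap A x - projMap A y| * (1 - x * y)
      ≤ |A 0 0 * A 1 1 - A 0 1 * A 1 0| / (A 0 0 * A 1 1 + A 0 1 * A 1 0)
        * (1 - projMap A x * projMap A y) * |(x : ℝ) - y| := by
  have hgx := growth_pos hA x
  have hgy := growth_pos hA y
  obtain ⟨x, hx1, hx2⟩ := x
  obtain ⟨y, hy1, hy2⟩ := y
  change 0 < growth A x at hgx
  change 0 < growth A y at hgy
  have h00 := hA 0 0; have h01 := hA 0 1; have h10 := hA 1 0; have h11 := hA 1 1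
  have hS : 0 < A 0 0 * A 1 1 + A 0 1 * A 1 0 := by positivity
  have hf (x : ℝ) : projMap A x = (projMatrix A 0 0 * x + projMatrix A 0 1) / growth A x := rfl
  have e1 : projMap A x - projMap A y
      = (A 0 0 * A 1 1 - A 0 1 * A 1 0) * (x - y) / (growth A x * growth A y) := by
    rw [hf, hf, div_sub_div _ _ hgx.ne' hgy.ne']
    congr 1
    simp [projMatrix, growth]; ring
  -- After clearing the growth factors, the difference of the two sides is the sum of the
  -- nonnegative terms in `p1` and `p2`.
  have e2 : (A 0 0 * A 1 1 + A 0 1 * A 1 0) * (1 - x * y) / (growth A x * growth A y)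
      ≤ 1 - projMap A x * projMap A y := by
    rw [hf, hf, div_mul_div_comm, le_sub_iff_add_le, ← add_div,
      div_le_one (mul_pos hgx hgy)]
    have p1 : 0 ≤ A 0 0 * A 1 0 * ((1 + x) * (1 + y)) := by
      have := mul_nonneg (a := 1 + x) (b := 1 + y) (by linarith) (by linarith)
      positivity
    have p2 : 0 ≤ A 0 1 * A 1 1 * ((1 - x) * (1 - y)) := by
      have := mul_nonneg (a := 1 - x) (b := 1 - y) (by linarith) (by linarith)
      positivity
    simp [projMatrix, growth]
    linarith
  have hxy : 0 ≤ 1 - x * y := by nlinarith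
  change |projMap A x - projMap A y| * (1 - x * y) ≤ _ / _ * (1 - projMap A x * projMap A y) * |x - y|
  calc |projMap A x - projMap A y| * (1 - x * y)
      = |A 0 0 * A 1 1 - A 0 1 * A 1 0| / (A 0 0 * A 1 1 + A 0 1 * A 1 0)
        * ((A 0 0 * A 1 1 + A 0 1 * A 1 0) * (1 - x * y) / (growth A x * growth A y))
          * |x - y| := by
        rw [e1, abs_div, abs_mul, abs_of_pos (mul_pos hgx hgy)]
        field_simp
    _ ≤ _ := by gcongr

theorem contraction_ratio_lt_one (hA : ∀ a b, 0 < A a b) :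
    |A 0 0 * A 1 1 - A 0 1 * A 1 0| / (A 0 0 * A 1 1 + A 0 1 * A 1 0) < 1 := by
  have h1 := mul_pos (hA 0 0) (hA 1 1)
  have h2 := mul_pos (hA 0 1) (hA 1 0)
  rw [div_lt_one (by positivity), abs_lt]
  constructor <;> linarith

theorem abs_log_growth_sub_le (hA : ∀ a b, 0 < A a b) (x y : State) :
    |Real.log (growth A x) - Real.log (growth A y)|
      ≤ |projMatrix A 1 0| / (projMatrix A 1 1 - |projMatrix A 1 0|) * |(x : ℝ) - y| := by
  have key (x y : State) : Real.log (growth A x) - Real.log (growth A y)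
      ≤ |projMatrix A 1 0| / (projMatrix A 1 1 - |projMatrix A 1 0|) * |(x : ℝ) - y| := by
    have hd := sub_pos.mpr (abs_projMatrix_bottom_lt hA)
    have hx := growth_pos hA x
    have hy := growth_pos hA y
    rw [← Real.log_div hx.ne' hy.ne']
    have h1 := Real.log_le_sub_one_of_pos (div_pos hx hy)
    have h2 : growth A x / growth A y - 1 = projMatrix A 1 0 * (x - y) / growth A y := by
      rw [div_sub_one hy.ne']; congr 1; simp [growth]; ring
    rw [h2] at h1
    refine h1.trans ((le_abs_self _).trans ?_)
    rw [abs_div, abs_mul, abs_of_pos hy, mul_div_right_comm]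
    gcongr
    exact growth_lower A y
  refine abs_le.mpr ⟨?_, key x y⟩
  have := key y x
  rw [abs_sub_comm] at this
  linarith

end Matrix

/-! ### Exponential convergence of the averages -/

section Convergence

variable {I : Type*} [Fintype I] {A : I → Matrix (Fin 2) (Fin 2) ℝ} {w : I → ℝ}

/-- The Lipschitz constant with respect to `|x - y| / (1 - x y)` shrinks by `ρ` under each `f_i`,
hence under their convex combination. -/
theorem transfer_contract (hA : ∀ i a b, 0 < A i a b) (hw : ∀ i, 0 < w i) (hw1 : ∑ i, w i = 1)
    {ρ : ℝ} (hρ : ∀ i, |A i 0 0 * A i 1 1 - A i 0 1 * A i 1 0|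
      / (A i 0 0 * A i 1 1 + A i 0 1 * A i 1 0) ≤ ρ)
    {g : State → ℝ} {C : ℝ} (hC : 0 ≤ C)
    (hg : ∀ x y : State, |g x - g y| * (1 - x * y) ≤ C * |(x : ℝ) - y|) (x y : State) :
    |transfer w (fun i => stateMap (hA i)) g x - transfer w (fun i => stateMap (hA i)) g y|
      * (1 - x * y) ≤ C * ρ * |(x : ℝ) - y| := by
  have hxy : 0 ≤ 1 - (x : ℝ) * y := by
    obtain ⟨x, hx1, hx2⟩ := x
    obtain ⟨y, hy1, hy2⟩ := y
    change 0 ≤ 1 - x * y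
    nlinarith
  -- The factor `1 - f_i(x) f_i(y)` can be cancelled, since the images lie in the open interval.
  have h1 (i : I) : |g (stateMap (hA i) x) - g (stateMap (hA i) y)| * (1 - x * y)
      ≤ C * ρ * |(x : ℝ) - y| := by
    have e1 : 0 < 1 - projMap (A i) x * projMap (A i) y := by
      have hx := abs_lt.mp (abs_projMap_lt_one (hA i) x)
      have hy := abs_lt.mp (abs_projMap_lt_one (hA i) y)
      nlinarith
    have e2 : |g (stateMap (hA i) x) - g (stateMap (hA i) y)|
        * (1 - projMap (A i) x * projMap (A i) y) ≤ C * |projMap (A i) x - projMap (A i) y| :=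
      hg (stateMap (hA i) x) (stateMap (hA i) y)
    have e3 := stateMap_contract (hA i) x y
    refine le_of_mul_le_mul_right ?_ e1
    calc _ = |g (stateMap (hA i) x) - g (stateMap (hA i) y)|
        * (1 - projMap (A i) x * projMap (A i) y) * (1 - x * y) := by ring
      _ ≤ C * |projMap (A i) x - projMap (A i) y| * (1 - x * y) := by gcongr
      _ = C * (|projMap (A i) x - projMap (A i) y| * (1 - x * y)) := by ring
      _ ≤ C * (_ * (1 - projMap (A i) x * projMap (A i) y) * |(x : ℝ) - y|) := by gcongr
      _ ≤ C * (ρ * (1 - projMap (A i) x * projMap (A i) y) * |(x : ℝ) - y|) := by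
        gcongr
        exact hρ i
      _ = _ := by ring
  simp only [transfer_apply, smul_eq_mul, ← Finset.sum_sub_distrib, ← mul_sub]
  calc _ ≤ (∑ i, w i * |g (stateMap (hA i) x) - g (stateMap (hA i) y)|) * (1 - x * y) := by
        gcongr
        refine (Finset.abs_sum_le_sum_abs _ _).trans_eq (Finset.sum_congr rfl fun i _ => ?_)
        rw [abs_mul, abs_of_pos (hw i)]
    _ = ∑ i, w i * (|g (stateMap (hA i) x) - g (stateMap (hA i) y)| * (1 - x * y)) := by
        rw [Finset.sum_mul]; simp only [mul_assoc]
    _ ≤ ∑ i, w i * (C * ρ * |(x : ℝ) - y|) :=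
        Finset.sum_le_sum fun i _ => mul_le_mul_of_nonneg_left (h1 i) (hw i).le
    _ = _ := by rw [← Finset.sum_mul, hw1, one_mul]

/-- The averaged logarithmic growth. -/
noncomputable def meanLogGrowth (A : I → Matrix (Fin 2) (Fin 2) ℝ) (w : I → ℝ) (x : State) : ℝ :=
  ∑ i, w i * Real.log (growth (A i) x)

theorem exists_ratio_bound (hA : ∀ i a b, 0 < A i a b) :
    ∃ ρ : ℝ, 0 ≤ ρ ∧ ρ < 1 ∧ ∀ i, |A i 0 0 * A i 1 1 - A i 0 1 * A i 1 0|
      / (A i 0 0 * A i 1 1 + A i 0 1 * A i 1 0) ≤ ρ := by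
  have h0 (i : I) : 0 ≤ |A i 0 0 * A i 1 1 - A i 0 1 * A i 1 0|
      / (A i 0 0 * A i 1 1 + A i 0 1 * A i 1 0) := by
    have h1 := mul_pos (hA i 0 0) (hA i 1 1)
    have h2 := mul_pos (hA i 0 1) (hA i 1 0)
    positivity
  rcases isEmpty_or_nonempty I with hI | hI
  · exact ⟨0, le_rfl, one_pos, fun i => (hI.false i).elim⟩
  · obtain ⟨j, hj⟩ := Finite.exists_max fun i => |A i 0 0 * A i 1 1 - A i 0 1 * A i 1 0|
      / (A i 0 0 * A i 1 1 + A i 0 1 * A i 1 0)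
    exact ⟨_, h0 j, contraction_ratio_lt_one (hA j), hj⟩

theorem exists_geometric_bound (hA : ∀ i a b, 0 < A i a b) (hw : ∀ i, 0 < w i)
    (hw1 : ∑ i, w i = 1) :
    ∃ ρ C : ℝ, 0 ≤ ρ ∧ ρ < 1 ∧ ∀ n : ℕ,
      |(transfer w (fun i => stateMap (hA i)) ^ (n + 1)) (meanLogGrowth A w) origin
        - (transfer w (fun i => stateMap (hA i)) ^ n) (meanLogGrowth A w) origin| ≤ C * ρ ^ n := by
  obtain ⟨ρ, hρ0, hρ1, hρ⟩ := exists_ratio_bound hA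
  set B : I → ℝ := fun i =>
    |projMatrix (A i) 1 0| / (projMatrix (A i) 1 1 - |projMatrix (A i) 1 0|) with hB
  have hB0 (i : I) : 0 ≤ B i :=
    div_nonneg (abs_nonneg _) (sub_pos.mpr (abs_projMatrix_bottom_lt (hA i))).le
  -- The sum is a Euclidean Lipschitz constant of `meanLogGrowth`; the factor `2` bounds the weight
  -- `1 - x y`.
  set C : ℝ := 2 * ∑ i, w i * B i with hCdef
  have hC : 0 ≤ C :=
    mul_nonneg zero_le_two (Finset.sum_nonneg fun i _ => mul_nonneg (hw i).le (hB0 i))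
  have h0 (x y : State) : |meanLogGrowth A w x - meanLogGrowth A w y| * (1 - x * y)
      ≤ C * |(x : ℝ) - y| := by
    have e1 : |meanLogGrowth A w x - meanLogGrowth A w y| ≤ (∑ i, w i * B i) * |(x : ℝ) - y| := by
      simp only [meanLogGrowth, ← Finset.sum_sub_distrib, ← mul_sub]
      rw [Finset.sum_mul]
      refine (Finset.abs_sum_le_sum_abs _ _).trans (Finset.sum_le_sum fun i _ => ?_)
      rw [abs_mul, abs_of_pos (hw i), mul_assoc]
      exact mul_le_mul_of_nonneg_left (abs_log_growth_sub_le (hA i) x y) (hw i).le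
    have e2 : 1 - (x : ℝ) * y ≤ 2 := by
      obtain ⟨x, hx1, hx2⟩ := x
      obtain ⟨y, hy1, hy2⟩ := y
      change 1 - x * y ≤ 2
      nlinarith
    calc _ ≤ |meanLogGrowth A w x - meanLogGrowth A w y| * 2 := by gcongr
      _ ≤ (∑ i, w i * B i) * |(x : ℝ) - y| * 2 := by gcongr
      _ = _ := by rw [hCdef]; ring
  have hn (n : ℕ) (x y : State) :
      |(transfer w (fun i => stateMap (hA i)) ^ n) (meanLogGrowth A w) x
        - (transfer w (fun i => stateMap (hA i)) ^ n) (meanLogGrowth A w) y| * (1 - x * y)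
      ≤ C * ρ ^ n * |(x : ℝ) - y| := by
    induction n generalizing x y with
    | zero => simpa using h0 x y
    | succ n ih =>
      rw [pow_succ', Module.End.mul_apply, pow_succ, ← mul_assoc]
      exact transfer_contract hA hw hw1 hρ (by positivity) ih x y
  refine ⟨ρ, C, hρ0, hρ1, fun n => ?_⟩
  set G := (transfer w (fun i => stateMap (hA i)) ^ n) (meanLogGrowth A w) with hG
  rw [pow_succ', Module.End.mul_apply, ← hG, transfer_apply]
  have e1 : ∑ i, w i • G (stateMap (hA i) origin) - G origin
      = ∑ i, w i * (G (stateMap (hA i) origin) - G origin) := by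
    simp only [mul_sub, Finset.sum_sub_distrib, ← Finset.sum_mul, hw1, one_mul, smul_eq_mul]
  rw [e1]
  calc _ ≤ ∑ i, w i * (C * ρ ^ n) := by
        refine (Finset.abs_sum_le_sum_abs _ _).trans (Finset.sum_le_sum fun i _ => ?_)
        rw [abs_mul, abs_of_pos (hw i)]
        refine mul_le_mul_of_nonneg_left ?_ (hw i).le
        -- At the origin the weight `1 - x y` equals `1`.
        have e2 := hn n (stateMap (hA i) origin) origin
        have e3 : ((origin : State) : ℝ) = 0 := rfl
        rw [e3, mul_zero, sub_zero, mul_one, sub_zero] at e2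
        exact e2.trans (mul_le_of_le_one_right (by positivity)
          (abs_projMap_lt_one (hA i) origin).le)
    _ = _ := by rw [← Finset.sum_mul, hw1, one_mul]

/-- The increments of the sequence of averages, the zeroth one being its initial value. -/
noncomputable def averageIncrement (hA : ∀ i a b, 0 < A i a b) (w : I → ℝ) : ℕ → ℝ
  | 0 => meanLogGrowth A w origin
  | n + 1 => (transfer w (fun i => stateMap (hA i)) ^ (n + 1)) (meanLogGrowth A w) origin
      - (transfer w (fun i => stateMap (hA i)) ^ n) (meanLogGrowth A w) origin

theorem sum_averageIncrement (hA : ∀ i a b, 0 < A i a b) (w : I → ℝ) (n : ℕ) :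
    ∑ k ∈ Finset.range (n + 1), averageIncrement hA w k
      = (transfer w (fun i => stateMap (hA i)) ^ n) (meanLogGrowth A w) origin := by
  induction n with
  | zero => simp [averageIncrement]
  | succ n ih => rw [Finset.sum_range_succ, ih, averageIncrement]; ring

theorem exists_hasSum_averageIncrement (hA : ∀ i a b, 0 < A i a b) (hw : ∀ i, 0 < w i)
    (hw1 : ∑ i, w i = 1) :
    ∃ L : ℝ, HasSum (averageIncrement hA w) L ∧ Tendsto (fun n : ℕ =>
      (transfer w (fun i => stateMap (hA i)) ^ n) (meanLogGrowth A w) origin) atTop (𝓝 L) := by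
  obtain ⟨ρ, C, hρ0, hρ1, hn⟩ := exists_geometric_bound hA hw hw1
  have h1 : Summable (averageIncrement hA w) := by
    rw [← summable_nat_add_iff 1]
    exact Summable.of_norm_bounded ((summable_geometric_of_lt_one hρ0 hρ1).mul_left C) hn
  refine ⟨_, h1.hasSum, ?_⟩
  have h2 := (tendsto_add_atTop_iff_nat 1).mpr h1.hasSum.tendsto_sum_nat
  simpa only [sum_averageIncrement] using h2

end Convergence

/-! ### The iterates of the operator -/

section Iterates

variable {I : Type*} [Fintype I] {A : I → Matrix (Fin 2) (Fin 2) ℝ} {w : I → ℝ}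

/-- The sequence `v(x ; 0)` as an element of `V`. -/
noncomputable def kernelPoint (x : State) : kernelSpan :=
  ⟨kernelVec ((x : ℝ) : ℂ) 0, kernelVec_mem (by
    rw [Complex.norm_real]; exact abs_le.mpr x.2) 0⟩

/-- The sequence `(1, 0, 0, …)`. -/
noncomputable def kernelUnit : kernelSpan := ⟨kernelVec 0 1, kernelVec_mem (by simp) 1⟩

theorem kernelVec_zero_apply (c : ℂ) (k : ℕ) : kernelVec 0 c k = if k = 0 then c else 0 := by
  by_cases hk : k = 0 <;> simp [kernelVec, hk]

theorem kernelVec_add_const (x d : ℂ) :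
    kernelVec x 0 + d • (kernelUnit : ℕ → ℂ) = kernelVec x d := by
  funext k
  by_cases hk : k = 0 <;> simp [kernelUnit, kernelVec, hk]

/-- Column `0` of the matrix vanishes. In the closed formula at `x = 0`, the logarithm is `0` and
the two kernel vectors cancel. -/
theorem kernelOp_kernelUnit (hA : ∀ i a b, 0 < A i a b) (w : I → ℝ) :
    kernelOp hA w kernelUnit = 0 := by
  apply Subtype.ext
  rw [kernelOp_eq_of_kernelVec hA w (x := 0) (c := 1) (by simp) rfl]
  refine Finset.sum_eq_zero fun i _ => ?_
  have := ofReal_projMap (A i) 0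
  rw [Complex.ofReal_zero] at this
  simp [this]

theorem log_growth_eq {B : Matrix (Fin 2) (Fin 2) ℝ} (hB : ∀ a b, 0 < B a b) (x : State) :
    Complex.log (1 + projMapT B 0 * (x : ℝ))
      = ((Real.log (growth B x) - Real.log (growth B origin) : ℝ) : ℂ) := by
  have h0 : growth B origin = projMatrix B 1 1 := by simp [growth, origin]
  have h1 : 1 + projMapT B 0 * x = growth B x / growth B origin := by
    have := (growth_pos hB origin).ne'
    rw [h0] at this ⊢
    rw [projMapT_zero, growth]
    field_simp
    ring
  rw [← Real.log_div (growth_pos hB x).ne' (growth_pos hB origin).ne', ← h1, Complex.ofReal_log]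
  · simp
  · rw [h1]; exact (div_pos (growth_pos hB x) (growth_pos hB origin)).le

theorem kernelOp_kernelPoint (hA : ∀ i a b, 0 < A i a b) (w : I → ℝ) (x : State) :
    kernelOp hA w (kernelPoint x)
      = transfer (fun i => (w i : ℂ)) (fun i => stateMap (hA i)) kernelPoint x
        - transfer (fun i => (w i : ℂ)) (fun i => stateMap (hA i)) kernelPoint origin
        + ((meanLogGrowth A w x - meanLogGrowth A w origin : ℝ) : ℂ) • kernelUnit := by
  apply Subtype.ext
  have hx : ‖((x : ℝ) : ℂ)‖ ≤ 1 := by rw [Complex.norm_real]; exact abs_le.mpr x.2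
  rw [kernelOp_eq_of_kernelVec hA w hx rfl]
  simp only [meanLogGrowth, transfer_apply, ← Finset.sum_sub_distrib, ← mul_sub, ← smul_sub]
  rw [Complex.ofReal_sum, Finset.sum_smul, ← Finset.sum_add_distrib,
    AddSubmonoidClass.coe_finsetSum]
  refine Finset.sum_congr rfl fun i _ => ?_
  rw [log_growth_eq (hA i), Complex.ofReal_mul, mul_smul, ← smul_add, ← ofReal_projMap,
    ← kernelVec_add_const]
  simp only [Submodule.coe_smul, Submodule.coe_add, Submodule.coe_sub, kernelPoint, stateMap,
    origin]
  congr 1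
  abel

theorem kernelPoint_origin : kernelPoint origin = 0 := by
  apply Subtype.ext
  funext k
  have : ((origin : State) : ℝ) = 0 := rfl
  simp [kernelPoint, this, kernelVec_zero_apply]

/-- `kernelOp_kernelPoint` is averaged over `n` steps; the parts evaluated at the origin are
constants, which the averaging fixes because the weights sum to `1`. -/
theorem kernelOp_transfer_pow (hA : ∀ i a b, 0 < A i a b) (hw1 : ∑ i, w i = 1) (n : ℕ) :
    kernelOp hA w ((transfer (fun i => (w i : ℂ)) (fun i => stateMap (hA i)) ^ n)
        kernelPoint origin)
      = (transfer (fun i => (w i : ℂ)) (fun i => stateMap (hA i)) ^ (n + 1)) kernelPoint origin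
        - (transfer (fun i => (w i : ℂ)) (fun i => stateMap (hA i)) ^ 1) kernelPoint origin
        + (((transfer w (fun i => stateMap (hA i)) ^ n) (meanLogGrowth A w) origin
          - meanLogGrowth A w origin : ℝ) : ℂ) • kernelUnit := by
  have hwC : ∑ i, (w i : ℂ) = 1 := by exact_mod_cast hw1
  set Q : (State → kernelSpan) →ₗ[ℂ] (State → kernelSpan) :=
    transfer (fun i => (w i : ℂ)) (fun i => stateMap (hA i)) with hQ
  have h1 : (fun x => kernelOp hA w (kernelPoint x))
      = Q kernelPoint - (fun _ => Q kernelPoint origin)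
        + fun x => LinearMap.toSpanSingleton ℂ kernelSpan kernelUnit
          ((meanLogGrowth A w x - meanLogGrowth A w origin : ℝ) : ℂ) := by
    funext x
    exact kernelOp_kernelPoint hA w x
  have h2 : (transfer w (fun i => stateMap (hA i)) ^ n)
      (fun x => meanLogGrowth A w x - meanLogGrowth A w origin) origin
      = (transfer w (fun i => stateMap (hA i)) ^ n) (meanLogGrowth A w) origin
        - meanLogGrowth A w origin := by
    have := map_sub (transfer w (fun i => stateMap (hA i)) ^ n) (meanLogGrowth A w)
      (fun _ => meanLogGrowth A w origin)
    rw [transfer_pow_const hw1] at this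
    exact congrFun this origin
  rw [transfer_pow_comp, h1, map_add, map_sub, ← hQ, hQ, transfer_pow_const hwC, Pi.add_apply,
    Pi.sub_apply, ← transfer_pow_comp, ← ofReal_transfer_pow, h2, pow_one, pow_succ,
    Module.End.mul_apply]
  rfl

theorem kernelOp_pow_apply (hA : ∀ i a b, 0 < A i a b) (hw1 : ∑ i, w i = 1) {v : kernelSpan}
    (hv : v = transfer (fun i => (w i : ℂ)) (fun i => stateMap (hA i)) kernelPoint origin
      + (meanLogGrowth A w origin : ℂ) • kernelUnit) (n : ℕ) :
    (kernelOp hA w ^ n) v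
      = (transfer (fun i => (w i : ℂ)) (fun i => stateMap (hA i)) ^ (n + 1)) kernelPoint origin
        - (transfer (fun i => (w i : ℂ)) (fun i => stateMap (hA i)) ^ n) kernelPoint origin
        + (averageIncrement hA w n : ℂ) • kernelUnit := by
  induction n with
  | zero => simp [hv, averageIncrement, kernelPoint_origin]
  | succ n ih =>
    -- The terms `(Pκ)(0)` and `φ(0)` occur in both applications of `kernelOp_transfer_pow` and
    -- cancel in the difference.
    rw [pow_succ', Module.End.mul_apply, ih, map_add, map_sub, map_smul, kernelOp_kernelUnit,
      kernelOp_transfer_pow hA hw1, kernelOp_transfer_pow hA hw1, averageIncrement]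
    push_cast
    module

/-- The entry of index `0`. -/
def headEntry : kernelSpan →ₗ[ℂ] ℂ := LinearMap.proj 0 ∘ₗ kernelSpan.subtype

theorem kernelOp_pow_apply_zero (hA : ∀ i a b, 0 < A i a b) (hw1 : ∑ i, w i = 1) {v : kernelSpan}
    (hv : v = transfer (fun i => (w i : ℂ)) (fun i => stateMap (hA i)) kernelPoint origin
      + (meanLogGrowth A w origin : ℂ) • kernelUnit) (n : ℕ) :
    ((kernelOp hA w ^ n) v : ℕ → ℂ) 0 = averageIncrement hA w n := by
  change headEntry ((kernelOp hA w ^ n) v) = _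
  have h0 : (fun x => headEntry (kernelPoint x)) = 0 := by
    funext x
    simp [headEntry, kernelPoint, kernelVec]
  rw [kernelOp_pow_apply hA hw1 hv, map_add, map_sub, transfer_pow_comp, transfer_pow_comp, h0,
    map_zero, map_zero, map_smul]
  simp [headEntry, kernelUnit, kernelVec]

theorem initVec_eq (hA : ∀ i a b, 0 < A i a b) (hA' : ∀ i, IsUnit (A i)) (w : I → ℝ) :
    ((transfer (fun i => (w i : ℂ)) (fun i => stateMap (hA i)) kernelPoint origin
      + (meanLogGrowth A w origin : ℂ) • kernelUnit : kernelSpan) : ℕ → ℂ) = initVec A w := by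
  rw [meanLogGrowth, Complex.ofReal_sum, Finset.sum_smul, transfer_apply, ← Finset.sum_add_distrib,
    AddSubmonoidClass.coe_finsetSum, initVec]
  refine Finset.sum_congr rfl fun i _ => ?_
  have h1 : 1 / 2 * Real.log ((projMatrix (A i)).det / deriv (projMap (A i)) 0)
      = Real.log (growth (A i) origin) := by
    have h0 : growth (A i) origin = projMatrix (A i) 1 1 := by simp [growth, origin]
    rw [det_div_deriv_projMap (hA i) (hA' i), Real.log_pow, h0]
    push_cast; ring
  rw [h1, Complex.ofReal_mul, mul_smul, ← smul_add, ← kernelVec_add_const]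
  rfl

end Iterates

/-! ### Averages of almost additive sequences -/

/-- Cutting `[0, n)` into blocks of length `m` costs at most `C` per block, so `C / m` on average.
Fixing `m` with `C / m` and `E m / m - L` small, the block averages then settle as `n → ∞`. -/
theorem tendsto_div_of_blocks {a : ℕ → ℝ} {Y : ℕ → ℕ → ℝ} {E : ℕ → ℝ} {L C K : ℝ}
    (hK : ∀ n, |a (n + 1) - a n| ≤ K)
    (hC : ∀ m k, |a ((k + 1) * m) - a (k * m) - Y m k| ≤ C)
    (hY : ∀ m, Tendsto (fun N : ℕ => (∑ k ∈ Finset.range N, Y m k) / N) atTop (𝓝 (E m)))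
    (hE : Tendsto (fun m : ℕ => E m / m) atTop (𝓝 L)) :
    Tendsto (fun n : ℕ => a n / n) atTop (𝓝 L) := by
  have hC0 : 0 ≤ C := (abs_nonneg _).trans (hC 0 0)
  have hK0 : 0 ≤ K := (abs_nonneg _).trans (hK 0)
  rw [Metric.tendsto_atTop]
  intro ε hε
  obtain ⟨m, hm1, hmE, hmC⟩ : ∃ m : ℕ, 1 ≤ m ∧ |E m / m - L| < ε / 4 ∧ C / m < ε / 4 := by
    have h1 : ∀ᶠ m : ℕ in atTop, |E m / m - L| < ε / 4 :=
      hE.eventually (Metric.ball_mem_nhds L (by positivity : 0 < ε / 4))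
    have h2 : ∀ᶠ m : ℕ in atTop, C / (m : ℝ) < ε / 4 :=
      (tendsto_const_div_atTop_nhds_zero_nat C).eventually (gt_mem_nhds (by positivity))
    obtain ⟨m, h⟩ := ((eventually_ge_atTop 1).and (h1.and h2)).exists
    exact ⟨m, h⟩
  have hm0 : (0 : ℝ) < m := by exact_mod_cast hm1
  -- `D` collects the errors that do not grow with `n`: the incomplete last block, the initial
  -- value, and the replacement of `N * m` by `n` in front of `L`.
  set D := K * m + |a 0| + m * |L| with hD
  have hNtend : Tendsto (fun n : ℕ => n / m) atTop atTop :=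
    Nat.tendsto_div_const_atTop (by omega)
  have h1 : ∀ᶠ n : ℕ in atTop,
      |(∑ k ∈ Finset.range (n / m), Y m k) / ((n / m : ℕ) : ℝ) - E m| < ε / 4 :=
    hNtend.eventually
      ((hY m).eventually (Metric.ball_mem_nhds (E m) (by positivity : 0 < ε / 4)))
  have h2 : ∀ᶠ n : ℕ in atTop, D / (n : ℝ) < ε / 4 :=
    (tendsto_const_div_atTop_nhds_zero_nat D).eventually (gt_mem_nhds (by positivity))
  obtain ⟨n₀, hn₀⟩ := eventually_atTop.mp
    ((eventually_ge_atTop m).and (h1.and h2))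
  refine ⟨n₀, fun n hn => ?_⟩
  obtain ⟨hnm, h1, h2⟩ := hn₀ n hn
  have hn0 : (0 : ℝ) < n := by exact_mod_cast hm1.trans hnm
  set N := n / m with hN
  have hN1 : 1 ≤ N := (Nat.one_le_div_iff (by omega)).mpr hnm
  have hN0 : (0 : ℝ) < N := by exact_mod_cast hN1
  have hdecomp : N * m + n % m = n := by rw [hN, mul_comm]; exact Nat.div_add_mod n m
  have hmod : n % m < m := Nat.mod_lt _ (by omega)
  have hcast : (N : ℝ) * m + (n % m : ℕ) = n := by exact_mod_cast hdecomp
  have hr : ((n % m : ℕ) : ℝ) ≤ m := by exact_mod_cast hmod.le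
  have hr0 : (0 : ℝ) ≤ ((n % m : ℕ) : ℝ) := Nat.cast_nonneg _
  have t1 : |a n - a (N * m)| ≤ K * m := by
    have (r : ℕ) : |a (N * m + r) - a (N * m)| ≤ K * r := by
      induction r with
      | zero => simp
      | succ r ih =>
        have := hK (N * m + r)
        have e : a (N * m + (r + 1)) - a (N * m)
          = (a (N * m + r + 1) - a (N * m + r)) + (a (N * m + r) - a (N * m)) := by
          rw [add_assoc]; ring
        rw [e]
        refine (abs_add_le _ _).trans ?_
        push_cast
        linarith
    have := this (n % m)
    rw [hdecomp] at this
    exact this.trans (mul_le_mul_of_nonneg_left hr hK0)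
  have t2 (N : ℕ) : |a (N * m) - ∑ k ∈ Finset.range N, Y m k| ≤ |a 0| + C * N := by
    induction N with
    | zero => simp
    | succ N ih =>
      rw [Finset.sum_range_succ]
      have e : a ((N + 1) * m) - (∑ k ∈ Finset.range N, Y m k + Y m N)
        = (a ((N + 1) * m) - a (N * m) - Y m N)
          + (a (N * m) - ∑ k ∈ Finset.range N, Y m k) := by ring
      rw [e]
      refine (abs_add_le _ _).trans ?_
      push_cast
      linarith [hC m N]
  have t3 : |∑ k ∈ Finset.range N, Y m k - N * E m| ≤ N * (ε / 4) := by
    have e : ∑ k ∈ Finset.range N, Y m k - N * E m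
      = N * ((∑ k ∈ Finset.range N, Y m k) / N - E m) := by field_simp
    rw [e, abs_mul, abs_of_pos hN0]
    gcongr
  have t4 : |N * E m - n * L| ≤ N * m * (ε / 4) + m * |L| := by
    have e : N * E m - n * L = N * m * (E m / m - L) - ((n % m : ℕ) : ℝ) * L := by
      rw [← hcast]; field_simp; ring
    rw [e]
    refine (abs_sub _ _).trans ?_
    rw [abs_mul, abs_mul, abs_mul, abs_of_pos hN0, abs_of_pos hm0, abs_of_nonneg hr0]
    gcongr
  have hCm : C * N ≤ N * m * (ε / 4) := by
    rw [div_lt_iff₀ hm0] at hmC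
    nlinarith
  have hm1' : (1 : ℝ) ≤ m := by exact_mod_cast hm1
  have hNn : (N : ℝ) * m ≤ n := by linarith
  have hNn' : (N : ℝ) ≤ n := by nlinarith
  rw [div_lt_iff₀ hn0] at h2
  have tot : |a n - n * L| < ε * n := by
    have e : a n - n * L = (a n - a (N * m)) + (a (N * m) - ∑ k ∈ Finset.range N, Y m k)
      + (∑ k ∈ Finset.range N, Y m k - N * E m) + (N * E m - n * L) := by ring
    rw [e]
    have s1 := abs_add_le ((a n - a (N * m)) + (a (N * m) - ∑ k ∈ Finset.range N, Y m k)
      + (∑ k ∈ Finset.range N, Y m k - N * E m)) (N * E m - n * L)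
    have s2 := abs_add_le ((a n - a (N * m)) + (a (N * m) - ∑ k ∈ Finset.range N, Y m k))
      (∑ k ∈ Finset.range N, Y m k - N * E m)
    have s3 := abs_add_le (a n - a (N * m)) (a (N * m) - ∑ k ∈ Finset.range N, Y m k)
    have s4 := t2 N
    have s5 : (N : ℝ) * (ε / 4) ≤ n * (ε / 4) := by gcongr
    have s6 : (N : ℝ) * m * (ε / 4) ≤ n * (ε / 4) := by gcongr
    linarith
  rw [Real.dist_eq]
  have e : a n / n - L = (a n - n * L) / n := by field_simp
  rw [e, abs_div, abs_of_pos hn0, div_lt_iff₀ hn0]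
  exact tot

/-! ### Products of positive matrices -/

section Products

/-- The sum of the entries of a `2 × 2` matrix. -/
def entrySum (M : Matrix (Fin 2) (Fin 2) ℝ) : ℝ := M 0 0 + M 0 1 + M 1 0 + M 1 1

variable {I : Type*} {A : I → Matrix (Fin 2) (Fin 2) ℝ}

/-- The orbit of the state of `(1/2, 1/2)` along `ω`. -/
noncomputable def orbit (hA : ∀ i a b, 0 < A i a b) (ω : ℕ → I) : ℕ → State
  | 0 => origin
  | n + 1 => stateMap (hA (ω n)) (orbit hA ω n)

theorem entrySum_mul_of_rowSum {B M : Matrix (Fin 2) (Fin 2) ℝ} {x : ℝ}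
    (h0 : M 0 0 + M 0 1 = entrySum M * (1 + x) / 2)
    (h1 : M 1 0 + M 1 1 = entrySum M * (1 - x) / 2) :
    entrySum (B * M) = entrySum M * growth B x := by
  have : entrySum (B * M)
      = (B 0 0 + B 1 0) * (M 0 0 + M 0 1) + (B 0 1 + B 1 1) * (M 1 0 + M 1 1) := by
    simp only [entrySum, Matrix.mul_apply, Fin.sum_univ_two]; ring
  rw [this, h0, h1]
  simp [growth, projMatrix]; ring

/-- The row sums are the image of the vector `(1, 1)` under the product; its direction is the orbit
of the origin and its coordinate sum is the entry sum. -/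
theorem rowSum_matProd (hA : ∀ i a b, 0 < A i a b) (ω : ℕ → I) (n : ℕ) :
    0 < entrySum (matProd A ω n) ∧
    matProd A ω n 0 0 + matProd A ω n 0 1
      = entrySum (matProd A ω n) * (1 + orbit hA ω n) / 2 ∧
    matProd A ω n 1 0 + matProd A ω n 1 1
      = entrySum (matProd A ω n) * (1 - orbit hA ω n) / 2 := by
  induction n with
  | zero => simp [matProd, entrySum, orbit, origin]
  | succ n ih =>
    obtain ⟨hpos, h0, h1⟩ := ih
    have hg := growth_pos (hA (ω n)) (orbit hA ω n)
    have hx : ((orbit hA ω (n + 1) : State) : ℝ)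
      = (projMatrix (A (ω n)) 0 0 * orbit hA ω n + projMatrix (A (ω n)) 0 1)
        / growth (A (ω n)) (orbit hA ω n) := rfl
    simp only [matProd]
    rw [entrySum_mul_of_rowSum h0 h1, hx]
    refine ⟨mul_pos hpos hg, ?_, ?_⟩
    · have : (A (ω n) * matProd A ω n) 0 0 + (A (ω n) * matProd A ω n) 0 1
          = A (ω n) 0 0 * (matProd A ω n 0 0 + matProd A ω n 0 1)
            + A (ω n) 0 1 * (matProd A ω n 1 0 + matProd A ω n 1 1) := by
        simp only [Matrix.mul_apply, Fin.sum_univ_two]; ring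
      rw [this, h0, h1]
      field_simp
      simp [growth, projMatrix]; ring
    · have : (A (ω n) * matProd A ω n) 1 0 + (A (ω n) * matProd A ω n) 1 1
          = A (ω n) 1 0 * (matProd A ω n 0 0 + matProd A ω n 0 1)
            + A (ω n) 1 1 * (matProd A ω n 1 0 + matProd A ω n 1 1) := by
        simp only [Matrix.mul_apply, Fin.sum_univ_two]; ring
      rw [this, h0, h1]
      field_simp
      simp [growth, projMatrix]; ring

theorem entrySum_matProd_pos (hA : ∀ i a b, 0 < A i a b) (ω : ℕ → I) (n : ℕ) :
    0 < entrySum (matProd A ω n) := (rowSum_matProd hA ω n).1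

theorem log_entrySum_matProd_succ (hA : ∀ i a b, 0 < A i a b) (ω : ℕ → I) (n : ℕ) :
    Real.log (entrySum (matProd A ω (n + 1))) = Real.log (entrySum (matProd A ω n))
      + Real.log (growth (A (ω n)) (orbit hA ω n)) := by
  obtain ⟨hpos, h0, h1⟩ := rowSum_matProd hA ω n
  rw [matProd, entrySum_mul_of_rowSum h0 h1,
    Real.log_mul hpos.ne' (growth_pos (hA (ω n)) _).ne']

theorem matProd_nonneg (hA : ∀ i a b, 0 < A i a b) (ω : ℕ → I) (n : ℕ) (a b : Fin 2) :
    0 ≤ matProd A ω n a b := by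
  induction n generalizing a b with
  | zero =>
    rw [matProd, Matrix.one_apply]
    split_ifs <;> norm_num
  | succ n ih =>
    rw [matProd, Matrix.mul_apply]
    exact Finset.sum_nonneg fun j _ => mul_nonneg (hA _ _ _).le (ih _ _)

theorem matProd_add (A : I → Matrix (Fin 2) (Fin 2) ℝ) (ω : ℕ → I) (n m : ℕ) :
    matProd A ω (n + m) = matProd A (fun j => ω (n + j)) m * matProd A ω n := by
  induction m with
  | zero => simp [matProd]
  | succ m ih => rw [← add_assoc, matProd, matProd, ih, mul_assoc]

theorem exists_forall_le_of_continuous [Finite I] (F : I → State → ℝ)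
    (hF : ∀ i, Continuous (F i)) : ∃ K : ℝ, 0 ≤ K ∧ ∀ i x, F i x ≤ K := by
  have := Fintype.ofFinite I
  have h (i : I) : ∃ K : ℝ, ∀ x, F i x ≤ K := by
    obtain ⟨y, -, hy⟩ := isCompact_univ.exists_isMaxOn ⟨origin, Set.mem_univ _⟩
      (hF i).continuousOn
    exact ⟨F i y, fun x => hy (Set.mem_univ x)⟩
  choose K hK using h
  refine ⟨∑ i, |K i|, Finset.sum_nonneg fun i _ => abs_nonneg _, fun i x => ?_⟩
  exact (hK i x).trans ((le_abs_self _).trans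
    (Finset.single_le_sum (f := fun i => |K i|) (fun i _ => abs_nonneg _) (Finset.mem_univ i)))

theorem continuous_growth (B : Matrix (Fin 2) (Fin 2) ℝ) :
    Continuous fun x : State => growth B x := by
  unfold growth; fun_prop

theorem exists_orbit_bound [Finite I] (hA : ∀ i a b, 0 < A i a b) :
    ∃ C : ℝ, 0 ≤ C ∧ ∀ ω n, Real.exp (-C) ≤ (1 - |(orbit hA ω n : ℝ)|) / 2 := by
  obtain ⟨C, hC0, hC⟩ := exists_forall_le_of_continuous
    (fun i (x : State) => -Real.log ((1 - |projMap (A i) x|) / 2)) fun i => by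
      have hf : Continuous fun x : State => projMap (A i) x := by
        have : (fun x : State => projMap (A i) x) = fun x : State =>
          (projMatrix (A i) 0 0 * x + projMatrix (A i) 0 1) / growth (A i) x := rfl
        rw [this]
        exact Continuous.div (by fun_prop) (continuous_growth _)
          fun x => (growth_pos (hA i) x).ne'
      exact (Continuous.log ((continuous_const.sub hf.abs).div_const 2) fun x =>
        (half_pos (sub_pos.mpr (abs_projMap_lt_one (hA i) x))).ne').neg
  -- Compactness bounds every point after the first step; the extra `log 2` covers `n = 0`, where
  -- the right-hand side is `1 / 2`.
  refine ⟨C + Real.log 2, by positivity, fun ω n => ?_⟩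
  rw [neg_add, Real.exp_add, Real.exp_neg (Real.log 2), Real.exp_log two_pos]
  rcases n with _ | n
  · have : ((orbit hA ω 0 : State) : ℝ) = 0 := rfl
    rw [this, abs_zero]
    have := Real.exp_le_one_iff.mpr (neg_nonpos.mpr hC0)
    linarith
  · have h1 : 0 < (1 - |projMap (A (ω n)) (orbit hA ω n)|) / 2 :=
      half_pos (sub_pos.mpr (abs_projMap_lt_one (hA (ω n)) _))
    have h2 := Real.exp_le_exp.mpr (neg_le.mp (hC (ω n) (orbit hA ω n)))
    rw [Real.exp_log h1] at h2
    change _ ≤ (1 - |projMap (A (ω n)) (orbit hA ω n)|) / 2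
    have := Real.exp_pos (-C)
    linarith

/-- The entry sum of a product pairs the column sums of the later factor with the row sums of the
earlier one. Each row sum lies between `exp (-C)` and `1` times the earlier entry sum, since the
orbit stays away from `±1`. -/
theorem exists_almost_additive [Finite I] (hA : ∀ i a b, 0 < A i a b) :
    ∃ C : ℝ, ∀ ω n m, |Real.log (entrySum (matProd A ω (n + m)))
      - Real.log (entrySum (matProd A ω n))
      - Real.log (entrySum (matProd A (fun j => ω (n + j)) m))| ≤ C := by
  obtain ⟨C, hC0, hC⟩ := exists_orbit_bound hA
  refine ⟨C, fun ω n m => ?_⟩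
  obtain ⟨hpos, h0, h1⟩ := rowSum_matProd hA ω n
  have hposm := entrySum_matProd_pos hA (fun j => ω (n + j)) m
  have hx := hC ω n
  have hx1 := (orbit hA ω n).2
  rw [Set.mem_Icc] at hx1
  have hx2 := le_abs_self (orbit hA ω n : ℝ)
  have hx3 := neg_abs_le (orbit hA ω n : ℝ)
  have hnn := matProd_nonneg hA (fun j => ω (n + j)) m
  have hsum := entrySum_matProd_pos hA ω (n + m)
  have hmul : entrySum (matProd A ω (n + m)) =
      (matProd A (fun j => ω (n + j)) m 0 0 + matProd A (fun j => ω (n + j)) m 1 0)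
        * (entrySum (matProd A ω n) * (1 + orbit hA ω n) / 2)
      + (matProd A (fun j => ω (n + j)) m 0 1 + matProd A (fun j => ω (n + j)) m 1 1)
        * (entrySum (matProd A ω n) * (1 - orbit hA ω n) / 2) := by
    rw [← h0, ← h1, matProd_add]
    simp only [entrySum, Matrix.mul_apply, Fin.sum_univ_two]; ring
  set s := entrySum (matProd A ω n)
  set P := matProd A (fun j => ω (n + j)) m
  set x : ℝ := ((orbit hA ω n : State) : ℝ)
  have hc0 : 0 ≤ P 0 0 + P 1 0 := add_nonneg (hnn 0 0) (hnn 1 0)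
  have hc1 : 0 ≤ P 0 1 + P 1 1 := add_nonneg (hnn 0 1) (hnn 1 1)
  have hP : entrySum P = (P 0 0 + P 1 0) + (P 0 1 + P 1 1) := by simp only [entrySum]; ring
  have hup : entrySum (matProd A ω (n + m)) ≤ s * entrySum P := by
    have e : s * entrySum P = (P 0 0 + P 1 0) * (s * 1) + (P 0 1 + P 1 1) * (s * 1) := by
      rw [hP]; ring
    rw [hmul, e, mul_div_assoc, mul_div_assoc]
    gcongr <;> linarith
  have hlow : Real.exp (-C) * (s * entrySum P) ≤ entrySum (matProd A ω (n + m)) := by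
    have e : Real.exp (-C) * (s * entrySum P)
      = (P 0 0 + P 1 0) * (s * Real.exp (-C)) + (P 0 1 + P 1 1) * (s * Real.exp (-C)) := by
      rw [hP]; ring
    rw [hmul, e, mul_div_assoc, mul_div_assoc]
    gcongr <;> linarith
  have l1 := Real.log_le_log hsum hup
  have l2 := Real.log_le_log (by positivity) hlow
  rw [Real.log_mul hpos.ne' hposm.ne'] at l1
  rw [Real.log_mul (Real.exp_pos _).ne' (by positivity), Real.log_mul hpos.ne' hposm.ne',
    Real.log_exp] at l2
  rw [abs_le]
  constructor <;> linarith

theorem exists_increment_bound [Finite I] (hA : ∀ i a b, 0 < A i a b) :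
    ∃ K : ℝ, ∀ ω n, |Real.log (entrySum (matProd A ω (n + 1)))
      - Real.log (entrySum (matProd A ω n))| ≤ K := by
  obtain ⟨K, -, hK⟩ := exists_forall_le_of_continuous
    (fun i (x : State) => |Real.log (growth (A i) x)|) fun i =>
      ((continuous_growth _).log fun x => (growth_pos (hA i) x).ne').abs
  refine ⟨K, fun ω n => ?_⟩
  rw [log_entrySum_matProd_succ hA, add_sub_cancel_left]
  exact hK _ _

theorem dependsOn_orbit (hA : ∀ i a b, 0 < A i a b) (n : ℕ) :
    DependsOn (fun ω => orbit hA ω n) (Finset.range n : Set ℕ) := by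
  intro ω ω' h
  induction n with
  | zero => rfl
  | succ n ih =>
    have h1 := ih fun i hi => h i (by simp at hi ⊢; omega)
    have h2 := h n (by simp)
    simp only [orbit] at h1 ⊢
    rw [h1]
    congr 1
    simp only [h2]

theorem dependsOn_matProd (A : I → Matrix (Fin 2) (Fin 2) ℝ) (n : ℕ) :
    DependsOn (fun ω => matProd A ω n) (Finset.range n : Set ℕ) := by
  intro ω ω' h
  induction n with
  | zero => rfl
  | succ n ih =>
    have h1 := ih fun i hi => h i (by simp at hi ⊢; omega)
    have h2 := h n (by simp)
    simp only [matProd] at h1 ⊢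
    rw [h1, h2]

end Products

/-! ### Norms -/

theorem exists_norm_comparison (N : Seminorm ℝ (Matrix (Fin 2) (Fin 2) ℝ))
    (hN : ∀ M, N M = 0 → M = 0) :
    ∃ B : ℝ, ∀ M : Matrix (Fin 2) (Fin 2) ℝ, (∀ a b, 0 ≤ M a b) → 0 < entrySum M →
      |Real.log (N M) - Real.log (entrySum M)| ≤ B := by
  have hcont : Continuous N := by
    -- A convex function on a finite-dimensional space is locally Lipschitz, so `N` is continuous.
    -- After scaling, it suffices to bound `log N` on the compact set of nonnegative matrices with
    -- entry sum `1`.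
    have h : ConvexOn ℝ Set.univ fun M : Fin 2 → Fin 2 → ℝ => N (Matrix.of M) :=
      N.convexOn.comp_linearMap (Matrix.ofLinearEquiv ℝ).toLinearMap
    exact h.locallyLipschitz.continuous
  have hsumcont : Continuous entrySum := by unfold entrySum; fun_prop
  set S : Set (Matrix (Fin 2) (Fin 2) ℝ) := {M | (∀ a b, 0 ≤ M a b) ∧ entrySum M = 1} with hS
  have hSc : IsCompact S := by
    have h1 : IsCompact {M : Matrix (Fin 2) (Fin 2) ℝ | ∀ a b, M a b ∈ Set.Icc (0 : ℝ) 1} := by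
      have := isCompact_univ_pi fun _ : Fin 2 =>
        isCompact_univ_pi fun _ : Fin 2 => isCompact_Icc (a := (0 : ℝ)) (b := 1)
      have e : {M : Matrix (Fin 2) (Fin 2) ℝ | ∀ a b, M a b ∈ Set.Icc (0 : ℝ) 1}
        = Set.univ.pi fun _ => Set.univ.pi fun _ => Set.Icc (0 : ℝ) 1 := by
        ext M
        exact ⟨fun h a _ b _ => h a b, fun h a b => h a trivial b trivial⟩
      rw [e]
      exact this
    refine h1.of_isClosed_subset ?_ fun M hM a b => ⟨hM.1 a b, ?_⟩
    · rw [hS, Set.ofPred_and]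
      refine IsClosed.inter ?_ (isClosed_eq hsumcont continuous_const)
      simp only [Set.ofPred_forall]
      exact isClosed_iInter fun a => isClosed_iInter fun b =>
        isClosed_le continuous_const (by fun_prop)
    · obtain ⟨h, hs⟩ := hM
      have := h 0 0; have := h 0 1; have := h 1 0; have := h 1 1
      rw [entrySum] at hs
      fin_cases a <;> fin_cases b <;> simp <;> linarith
  have hpos : ∀ M ∈ S, 0 < N M := fun M hM => (apply_nonneg N M).lt_of_ne' fun h => by
    have := hM.2
    rw [hN M h] at this
    simp [entrySum] at this
  have hlog : ContinuousOn (fun M => |Real.log (N M)|) S :=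
    (hcont.continuousOn.log fun M hM => (hpos M hM).ne').abs
  obtain ⟨B, hB⟩ := hSc.bddAbove_image hlog
  refine ⟨B, fun M hM hs => ?_⟩
  have hmem : (entrySum M)⁻¹ • M ∈ S := by
    refine ⟨fun a b => mul_nonneg (inv_nonneg.mpr hs.le) (hM a b), ?_⟩
    have : entrySum ((entrySum M)⁻¹ • M) = (entrySum M)⁻¹ * entrySum M := by
      simp [entrySum]; ring
    rw [this, inv_mul_cancel₀ hs.ne']
  have h1 := hB (Set.mem_image_of_mem _ hmem)
  have h2 := hpos _ hmem
  have h3 : N ((entrySum M)⁻¹ • M) = (entrySum M)⁻¹ * N M := by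
    rw [map_smul_eq_mul, Real.norm_of_nonneg (inv_nonneg.mpr hs.le)]
  simp only [h3] at h1 h2
  have h4 : 0 < N M := pos_of_mul_pos_right h2 (inv_nonneg.mpr hs.le)
  rw [Real.log_mul (inv_pos.mpr hs).ne' h4.ne', Real.log_inv] at h1
  rwa [sub_eq_neg_add]

/-! ### The Bernoulli measure -/

section Bernoulli

open ProbabilityTheory

theorem exists_eq_comp_restrict {I β : Type*} [Nonempty β] {S : Finset ℕ} {F : (ℕ → I) → β}
    (hF : DependsOn F (S : Set ℕ)) : ∃ G : (S → I) → β, ∀ ω, F ω = G fun i => ω i := by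
  obtain ⟨G, hG⟩ := dependsOn_iff_exists_comp.mp hF
  exact ⟨G, fun ω => congrFun hG ω⟩

variable {I : Type*} [Fintype I] [MeasurableSpace I] {w : I → ℝ}

theorem isProbabilityMeasure_letter (hw : ∀ i, 0 < w i) (hw1 : ∑ i, w i = 1) :
    IsProbabilityMeasure (∑ i, ENNReal.ofReal (w i) • Measure.dirac i) := by
  constructor
  simp only [Measure.coe_finsetSum, Finset.sum_apply, Measure.smul_apply, measure_univ,
    smul_eq_mul, mul_one]
  rw [← ENNReal.ofReal_sum_of_nonneg fun i _ => (hw i).le, hw1, ENNReal.ofReal_one]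

theorem isProbabilityMeasure_bernoulliMeasure (hw : ∀ i, 0 < w i) (hw1 : ∑ i, w i = 1) :
    IsProbabilityMeasure (bernoulliMeasure w) := by
  have := isProbabilityMeasure_letter hw hw1
  unfold bernoulliMeasure
  infer_instance

theorem map_shift_bernoulliMeasure (hw : ∀ i, 0 < w i) (hw1 : ∑ i, w i = 1) (n : ℕ) :
    (bernoulliMeasure w).map (fun ω j => ω (n + j)) = bernoulliMeasure w := by
  have := isProbabilityMeasure_letter hw hw1
  exact Measure.map_infinitePi_infinitePi_of_inj
    (P := fun _ : ℕ => ∑ i, ENNReal.ofReal (w i) • Measure.dirac i) (add_right_injective n)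

variable [DiscreteMeasurableSpace I]

theorem integral_letter (hw : ∀ i, 0 < w i) (hw1 : ∑ i, w i = 1) (φ : I → ℝ) (n : ℕ) :
    ∫ ω, φ (ω n) ∂(bernoulliMeasure w) = ∑ i, w i * φ i := by
  have := isProbabilityMeasure_letter hw hw1
  have h := measurePreserving_eval_infinitePi
    (fun _ : ℕ => ∑ i, ENNReal.ofReal (w i) • Measure.dirac i) n
  have h1 := integral_map (μ := bernoulliMeasure w) (φ := Function.eval n) (f := φ) h.measurable.aemeasurable
    Measurable.of_discrete.aestronglyMeasurable
  rw [bernoulliMeasure, h.map_eq, integral_finsetSum_measure] at h1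
  · refine h1.symm.trans (Finset.sum_congr rfl fun i _ => ?_)
    rw [integral_smul_measure, integral_dirac, ENNReal.toReal_ofReal (hw i).le, smul_eq_mul]
  · intro i _
    exact (integrable_dirac (by simp)).smul_measure ENNReal.ofReal_ne_top

theorem measurable_of_dependsOn {S : Finset ℕ} {F : (ℕ → I) → ℝ}
    (hF : DependsOn F (S : Set ℕ)) : Measurable F := by
  obtain ⟨G, hG⟩ := exists_eq_comp_restrict hF
  have : F = G ∘ fun ω (i : S) => ω i := funext hG
  rw [this]
  exact Measurable.of_discrete.comp (by fun_prop)

theorem integrable_of_dependsOn (hw : ∀ i, 0 < w i) (hw1 : ∑ i, w i = 1) {S : Finset ℕ}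
    {F : (ℕ → I) → ℝ} (hF : DependsOn F (S : Set ℕ)) : Integrable F (bernoulliMeasure w) := by
  have := isProbabilityMeasure_bernoulliMeasure hw hw1
  obtain ⟨G, hG⟩ := exists_eq_comp_restrict hF
  obtain ⟨C, hC⟩ := (Set.finite_range fun y => ‖G y‖).bddAbove
  refine Integrable.of_bound (measurable_of_dependsOn hF).aestronglyMeasurable C
    (Eventually.of_forall fun ω => ?_)
  rw [hG]
  exact hC ⟨_, rfl⟩

theorem indepFun_of_dependsOn (hw : ∀ i, 0 < w i) (hw1 : ∑ i, w i = 1) {S S' : Finset ℕ}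
    (hS : Disjoint S S') {F F' : (ℕ → I) → ℝ} (hF : DependsOn F (S : Set ℕ))
    (hF' : DependsOn F' (S' : Set ℕ)) : IndepFun F F' (bernoulliMeasure w) := by
  have := isProbabilityMeasure_letter hw hw1
  obtain ⟨G, hG⟩ := exists_eq_comp_restrict hF
  obtain ⟨G', hG'⟩ := exists_eq_comp_restrict hF'
  have h1 : iIndepFun (fun (n : ℕ) (ω : ℕ → I) => ω n) (bernoulliMeasure w) :=
    iIndepFun_infinitePi (X := fun _ x => x) fun _ => measurable_id
  have h2 := (h1.indepFun_finset S S' hS fun n => measurable_pi_apply n).comp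
    (Measurable.of_discrete (f := G)) (Measurable.of_discrete (f := G'))
  have e : F = G ∘ fun ω (i : S) => ω i := funext hG
  have e' : F' = G' ∘ fun ω (i : S') => ω i := funext hG'
  rw [e, e']
  exact h2

theorem identDistrib_shift (hw : ∀ i, 0 < w i) (hw1 : ∑ i, w i = 1) {S : Finset ℕ}
    {F : (ℕ → I) → ℝ} (hF : DependsOn F (S : Set ℕ)) (n : ℕ) :
    IdentDistrib (fun ω => F fun j => ω (n + j)) F (bernoulliMeasure w) (bernoulliMeasure w) := by
  have hm := measurable_of_dependsOn hF
  have hs : Measurable fun (ω : ℕ → I) (j : ℕ) => ω (n + j) := by fun_prop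
  refine ⟨(hm.comp hs).aemeasurable, hm.aemeasurable, ?_⟩
  conv_rhs => rw [← map_shift_bernoulliMeasure hw hw1 n, Measure.map_map hm hs]
  rfl

/-- Disjoint blocks of letters are independent and, by shift invariance, identically distributed, so
the strong law of large numbers applies. -/
theorem ae_tendsto_block_average (hw : ∀ i, 0 < w i) (hw1 : ∑ i, w i = 1) {m : ℕ}
    {F : (ℕ → I) → ℝ} (hF : DependsOn F (Finset.range m : Set ℕ)) :
    ∀ᵐ ω ∂(bernoulliMeasure w), Tendsto
      (fun n : ℕ => (∑ k ∈ Finset.range n, F fun j => ω (k * m + j)) / n) atTop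
      (𝓝 (∫ ω, F ω ∂(bernoulliMeasure w))) := by
  have hdep (k : ℕ) : DependsOn (fun ω : ℕ → I => F fun j => ω (k * m + j))
      (Finset.Ico (k * m) (k * m + m) : Set ℕ) := by
    intro ω ω' h
    refine hF fun i hi => h _ ?_
    simp at hi ⊢
    omega
  have h0 : (fun ω : ℕ → I => F fun j => ω (0 * m + j)) = F := by
    funext ω; simp
  have h := strong_law_ae_real (μ := bernoulliMeasure w)
    (fun (k : ℕ) ω => F fun j => ω (k * m + j))
    (by rw [h0]; exact integrable_of_dependsOn hw hw1 hF)
    (fun k l hkl => by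
      refine indepFun_of_dependsOn hw hw1 ?_ (hdep k) (hdep l)
      rw [Finset.disjoint_left]
      intro x hx hx'
      rw [Finset.mem_Ico] at hx hx'
      rcases lt_or_gt_of_ne hkl with h | h
      · have := Nat.mul_le_mul_right m h
        rw [Nat.succ_mul] at this
        omega
      · have := Nat.mul_le_mul_right m h
        rw [Nat.succ_mul] at this
        omega)
    (fun k => by
      rw [h0]
      exact identDistrib_shift hw hw1 hF (k * m))
  rw [h0] at h
  exact h

variable {A : I → Matrix (Fin 2) (Fin 2) ℝ}

/-- The state at time `n` depends only on the letters before `n`, so it is independent of the letter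
`ω n`. Splitting over the values of `ω n` lets each indicator factor out. -/
theorem integral_step (hA : ∀ i a b, 0 < A i a b) (hw : ∀ i, 0 < w i) (hw1 : ∑ i, w i = 1)
    (F : I → State → ℝ) (n : ℕ) :
    ∫ ω, F (ω n) (orbit hA ω n) ∂(bernoulliMeasure w)
      = ∫ ω, ∑ i, w i * F i (orbit hA ω n) ∂(bernoulliMeasure w) := by
  classical
  have hdep (i : I) : DependsOn (fun ω => F i (orbit hA ω n)) (Finset.range n : Set ℕ) :=
    fun ω ω' h => congrArg (F i) (dependsOn_orbit hA n h)
  have hdep' (i : I) : DependsOn (fun ω : ℕ → I => if ω n = i then (1 : ℝ) else 0)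
      (({n} : Finset ℕ) : Set ℕ) := by
    intro ω ω' h
    simp only [h n (by simp)]
  have hind (i : I) := indepFun_of_dependsOn hw hw1 (by simp) (hdep' i) (hdep i)
  have hint (i : I) := integrable_of_dependsOn hw hw1 (hdep i)
  have hint' (i : I) := integrable_of_dependsOn hw hw1 (hdep' i)
  have e : (fun ω : ℕ → I => F (ω n) (orbit hA ω n))
      = fun ω => ∑ i, (if ω n = i then (1 : ℝ) else 0) * F i (orbit hA ω n) := by
    funext ω
    simp
  have hmul (i : I) : Integrable (fun ω : ℕ → I =>
      (if ω n = i then (1 : ℝ) else 0) * F i (orbit hA ω n)) (bernoulliMeasure w) :=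
    (hind i).integrable_mul (hint' i) (hint i)
  rw [e, integral_finsetSum _ fun i _ => hmul i,
    integral_finsetSum _ fun i _ => (hint i).const_mul (w i)]
  refine Finset.sum_congr rfl fun i _ => ?_
  rw [(hind i).integral_fun_mul_eq_mul_integral (hint' i).aestronglyMeasurable
    (hint i).aestronglyMeasurable, integral_const_mul,
    integral_letter hw hw1 (fun j => if j = i then (1 : ℝ) else 0)]
  simp

theorem integral_orbit (hA : ∀ i a b, 0 < A i a b) (hw : ∀ i, 0 < w i) (hw1 : ∑ i, w i = 1)
    (n : ℕ) (g : State → ℝ) :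
    ∫ ω, g (orbit hA ω n) ∂(bernoulliMeasure w)
      = (transfer w (fun i => stateMap (hA i)) ^ n) g origin := by
  have := isProbabilityMeasure_bernoulliMeasure hw hw1
  induction n generalizing g with
  | zero => simp [orbit]
  | succ n ih =>
    -- The newest letter acts last on the state, so integrating it out replaces `g` by its one-step
    -- average.
    rw [pow_succ, Module.End.mul_apply, ← ih]
    exact integral_step hA hw hw1 (fun i x => g (stateMap (hA i) x)) n

theorem integral_log_entrySum (hA : ∀ i a b, 0 < A i a b) (hw : ∀ i, 0 < w i)
    (hw1 : ∑ i, w i = 1) (n : ℕ) :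
    ∫ ω, Real.log (entrySum (matProd A ω n)) ∂(bernoulliMeasure w)
      = Real.log 2 + ∑ k ∈ Finset.range n,
        (transfer w (fun i => stateMap (hA i)) ^ k) (meanLogGrowth A w) origin := by
  have := isProbabilityMeasure_bernoulliMeasure hw hw1
  induction n with
  | zero => norm_num [matProd, entrySum]
  | succ n ih =>
    rw [Finset.sum_range_succ, ← add_assoc, ← ih, ← integral_orbit hA hw hw1]
    simp only [log_entrySum_matProd_succ hA]
    rw [integral_add, integral_step hA hw hw1 (fun i x => Real.log (growth (A i) x))]
    · rfl
    · exact integrable_of_dependsOn hw hw1 (S := Finset.range n)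
        fun ω ω' h => congrArg (fun M => Real.log (entrySum M)) (dependsOn_matProd A n h)
    · refine integrable_of_dependsOn hw hw1 (S := Finset.range (n + 1)) fun ω ω' h => ?_
      have h1 : orbit hA ω n = orbit hA ω' n :=
        dependsOn_orbit hA n fun i hi => h i (by simp at hi ⊢; omega)
      rw [h1, h n (by simp)]

/-- The expected block value divided by `m` is, up to `log 2 / m`, a Cesàro mean of `(P^k φ)(0)`, so
it has the same limit. Replacing the entry sum by `N` changes the logarithm by a bounded amount. -/
theorem isTopLyapunovExponent_of_tendsto (hA : ∀ i a b, 0 < A i a b) (hw : ∀ i, 0 < w i)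
    (hw1 : ∑ i, w i = 1) {L : ℝ}
    (hL : Tendsto (fun n : ℕ => (transfer w (fun i => stateMap (hA i)) ^ n)
      (meanLogGrowth A w) origin) atTop (𝓝 L)) :
    IsTopLyapunovExponent A w L := by
  intro N hN
  obtain ⟨C, hC⟩ := exists_almost_additive hA
  obtain ⟨K, hK⟩ := exists_increment_bound hA
  obtain ⟨B, hB⟩ := exists_norm_comparison N hN
  have hE : Tendsto (fun m : ℕ => (∫ ω, Real.log (entrySum (matProd A ω m))
      ∂(bernoulliMeasure w)) / m) atTop (𝓝 L) := by
    simp only [integral_log_entrySum hA hw hw1, add_div]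
    have h := (tendsto_const_div_atTop_nhds_zero_nat (Real.log 2)).add hL.cesaro
    rw [zero_add] at h
    refine h.congr fun n => ?_
    rw [inv_mul_eq_div]
  have hblocks := ae_all_iff.mpr fun m : ℕ => ae_tendsto_block_average hw hw1 (m := m)
    (F := fun ω => Real.log (entrySum (matProd A ω m)))
    fun ω ω' h => congrArg (fun M => Real.log (entrySum M)) (dependsOn_matProd A m h)
  filter_upwards [hblocks] with ω hω
  have h1 : Tendsto (fun n : ℕ => Real.log (entrySum (matProd A ω n)) / n) atTop (𝓝 L) := by
    refine tendsto_div_of_blocks (hK ω) (fun m k => ?_) hω hE (C := C)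
    rw [Nat.succ_mul]
    exact hC ω (k * m) m
  have h2 : Tendsto (fun n : ℕ => (Real.log (N (matProd A ω n))
      - Real.log (entrySum (matProd A ω n))) / n) atTop (𝓝 0) := by
    refine squeeze_zero_norm (fun n => ?_) (tendsto_const_div_atTop_nhds_zero_nat B)
    rw [norm_div, Real.norm_natCast, Real.norm_eq_abs]
    gcongr
    exact hB _ (matProd_nonneg hA ω n) (entrySum_matProd_pos hA ω n)
  have h3 := h2.add h1
  rw [zero_add] at h3
  refine h3.congr fun n => ?_
  ring

end Bernoulli

end KernelExpansion

theorem theorem1 {I : Type*} [Fintype I] [MeasurableSpace I] [DiscreteMeasurableSpace I]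
    (A : I → Matrix (Fin 2) (Fin 2) ℝ)
    (hA_pos : ∀ i a b, 0 < A i a b)
    (hA_inv : ∀ i, IsUnit (A i))
    (w : I → ℝ) (hw_pos : ∀ i, 0 < w i) (hw_sum : ∑ i, w i = 1) :
    (∀ i, 0 < (KernelExpansion.projMatrix (A i)).det /
        deriv (KernelExpansion.projMap (A i)) 0) ∧
    ∃ T : KernelExpansion.kernelSpan →ₗ[ℂ] KernelExpansion.kernelSpan,
      (∀ (u : KernelExpansion.kernelSpan) (k : ℕ),
        HasSum (fun n : ℕ => (KernelExpansion.kernelCoeff A w k n : ℂ) * (u : ℕ → ℂ) n)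
          ((T u : ℕ → ℂ) k)) ∧
      ∃ v : KernelExpansion.kernelSpan,
        (v : ℕ → ℂ) = KernelExpansion.initVec A w ∧
        ∃ L : ℝ, KernelExpansion.IsTopLyapunovExponent A w L ∧
          HasSum (fun n : ℕ => (((T ^ n) v : KernelExpansion.kernelSpan) : ℕ → ℂ) 0) (L : ℂ) := by
  obtain ⟨L, hsum, hlim⟩ :=
    KernelExpansion.exists_hasSum_averageIncrement hA_pos hw_pos hw_sum
  refine ⟨fun i => ?_, KernelExpansion.kernelOp hA_pos w, KernelExpansion.hasSum_kernelOp hA_pos w,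
    _, KernelExpansion.initVec_eq hA_pos hA_inv w, L,
    KernelExpansion.isTopLyapunovExponent_of_tendsto hA_pos hw_pos hw_sum hlim, ?_⟩
  · rw [KernelExpansion.det_div_deriv_projMap (hA_pos i) (hA_inv i)]
    exact pow_pos (KernelExpansion.projMatrix_bottom_pos (hA_pos i)) 2
  · simp only [KernelExpansion.kernelOp_pow_apply_zero hA_pos hw_sum rfl]
    exact_mod_cast hsum
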